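/- Let $\Sigma$ be a closed connected oriented surface of genus $g\ge 1$ and let $\Omega=\{x_1,y_1,\dots,x_g,y_g\}$ be a symplectic basis, given by oriented simple closed curves that meet only at a base point $\infty$, with $x_i\cdot y_j=\delta_{ij}$, $x_i\cdot x_j=y_i\cdot y_j=0$ and $\prod_i[x_i,y_i]=1$ in $\pi_1(\Sigma,\infty)$. Let $D\subset\Sigma$ be a diagram of an oriented link $L\subset\Sigma\times[0,1]$, transverse to $\Omega$ and avoiding $\infty$, with no crossing on $\Omega$. *The CSW polynomial.* Let $X=\Sigma\times[0,1]\smallsetminus L$. Let $\varphi\colon\pi_1(X)\to\langle t\rangle\times H_1(\Sigma)$ send positive meridians to $t$ and loops in $\Sigma\times\{1\}$ to their homology classes. The Alexander module of $D$ is $A(D)=H_1(X,\Sigma\times\{1\};\mathbb Z[\langle t\rangle\times H_1(\Sigma)])$ with coefficients twisted by $\varphi$, where $\pi_1(X)$ is given by its Wirtinger presentation. The infinite cyclic Carter–Silver–Williams polynomial $\Delta^0_D(t,x_1,y_1,\dots,x_g,y_g)$ is any generator of the zeroth order (Fitting) ideal of $A(D)$. *The homotopy Zh-construction.* A diagram $\mathrm{Zh}_\Omega(D)$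 is a virtual link diagram in the plane obtained as follows. Draw a virtual link diagram with the Gauss diagram of $D$. For each point where $D$ meets $x_i$ with local sign $e=D\cdot x_i$, insert in the corresponding place an over-crossing arc of colour $y_i$ with crossing sign $e$. For each point where $D$ meets $y_i$ with $e=D\cdot y_i$, insert an over-crossing arc of colour $x_i$ with crossing sign $-e$. For each colour, join its arcs in any order to a single component (an unknotted circle, if there are none), all further intersections being virtual crossings. *The functor.* Let $V$ have the basis $v_1$ (even), $v_2$ (odd), and write the diagram as a composite of elementary tangles between identity strands, read upwards, with the strands of crossings oriented upwards. Upward strands of the link carry $V$, downward ones $V^*$, coloured strands the ground ring. The functor $\widetilde Q^{1|1}_\Omega$ takes the following values. - Negative crossing: $v_1\otimes v_1\mapsto q\,v_1\otimes v_1$, $v_1\otimes v_2\mapsto v_2\otimes v_1+(q-q^{-1})v_1\otimes v_2$, $v_2\otimes v_1\mapsto v_1\otimes v_2$, $v_2\otimes v_2\mapsto -q^{-1}v_2\otimes v_2$; positive crossing: the inverse map. - Virtual crossing of two link strands: $v_1\otimes v_1\mapsto v_1\otimes v_1$, $v_1\otimes v_2\mapsto q^{-1}v_2\otimes v_1$,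 $v_2\otimes v_1\mapsto q\,v_1\otimes v_2$, $v_2\otimes v_2\mapsto -v_2\otimes v_2$. - Cups: $1\mapsto v_1\otimes v_1^*+v_2\otimes v_2^*$ and $1\mapsto q^{-1}(v_1^*\otimes v_1-v_2^*\otimes v_2)$. Caps: $v_k^*\otimes v_k\mapsto 1$ and $v_1\otimes v_1^*\mapsto q$, $v_2\otimes v_2^*\mapsto -q$; both caps vanish on the remaining basis vectors. - Over-crossing by a strand of colour $z$ with crossing sign $s$: $v_1\mapsto v_1$, $v_2\mapsto z^{-s}v_2$. - All other virtual crossings, cups and caps involving coloured strands: the identity. **Theorem.** The zeroth order ideal of $A(D)$ is principal, so that $\Delta^0_D$ exists, and diagrams $\mathrm{Zh}_\Omega(D)$ exist. For every CSW polynomial $\Delta^0_D$ and every diagram $\mathrm{Zh}_\Omega(D)$ there is a unit $u$ of $\mathbb Z[\langle q\rangle\times H_1(\Sigma)]$ with $$\widetilde Q^{1|1}_\Omega(\mathrm{Zh}_\Omega(D))=u\cdot\Delta^0_D(q^{-2},x_1^{-1},y_1^{-1},\dots,x_g^{-1},y_g^{-1}).$$ -/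

import Mathlib

noncomputable section

namespace CSW

/-! ## Links on a closed oriented surface, relative to a symplectic basis

The surface `Σ` of genus `g` is cut along the curves `x₁, y₁, …, x_g, y_g` of a symplectic basis,
which meet only at the base point `∞`. A link diagram on `Σ`, transverse to these curves, is
recorded as a graph embedded in `Σ`: the union of the diagram and of the curves. -/

/-- The symplectic palette: `(i, false)` is `x_i` and `(i, true)` is `y_i`. -/
abbrev Palette (g : ℕ) : Type := Fin g × Bool

/-- The partner of a basis curve: `x_i ↔ y_i`. -/
def Palette.dual {g : ℕ} (z : Palette g) : Palette g := (z.1, !z.2)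

/-- What a point travelling along the link meets: the over- or the under-strand of one of `n`
classical crossings, the `k`-th intersection point (counted along the curve `z`) of the diagram
with the basis curve `z`, or one of `m` marked points. Marked points carry no information; they
are there so that a component without crossings and intersections is seen. -/
inductive Passage {g : ℕ} (n m : ℕ) (cuts : Palette g → ℕ) : Type
  | over (c : Fin n)
  | under (c : Fin n)
  | cut (z : Palette g) (k : Fin (cuts z))
  | mark (b : Fin m)

/-- The combinatorial data of an oriented link diagram on `Σ`, with the curves of `Ω` drawn in. -/
structure DiagramData (g : ℕ) where
  /-- number of classical crossings -/
  crossings : ℕ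
  /-- number of marked points -/
  marks : ℕ
  /-- number of intersection points with each basis curve -/
  cuts : Palette g → ℕ
  /-- the next passage along the oriented link; its cycles are the components -/
  next : Equiv.Perm (Passage crossings marks cuts)
  /-- signs of the crossings -/
  sign : Fin crossings → ℤˣ
  /-- the local intersection number `D · z` at each intersection point -/
  cutSign : (z : Palette g) → Fin (cuts z) → ℤˣ

variable {g : ℕ}

namespace DiagramData

/-- Passages of the diagram. A passage `p` also names the arc of the diagram that leaves `p`. -/
abbrev Pass (D : DiagramData g) : Type := Passage D.crossings D.marks D.cuts

/-- The half-edges of the graph `D ∪ Ω`. `strand p true` is the half-edge of `D` leaving `p`,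
`strand p false` the one arriving at `p`. The curve `z` is cut by `D` into the edges
`0, …, cuts z`, beginning and ending at `∞`; `curve z j true` is the initial half of the `j`-th
edge and `curve z j false` its final half. -/
inductive Dart (D : DiagramData g) : Type
  | strand (p : D.Pass) (out : Bool)
  | curve (z : Palette g) (j : Fin (D.cuts z + 1)) (start : Bool)

/-- The other half of the same edge. -/
def flip (D : DiagramData g) : D.Dart → D.Dart
  | .strand p true => .strand (D.next p) false
  | .strand p false => .strand (D.next.symm p) true
  | .curve z j s => .curve z j (!s)

/-- The next half-edge around the same vertex, counterclockwise. At a positive crossing the order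
is over-out, under-out, over-in, under-in; at a point with `D · z = 1` it is `D`-out, `z`-out,
`D`-in, `z`-in. At `∞` it is: end of `y_i`, start of `x_i`, start of `y_i`, end of `x_i`, for
`i = g, …, 1` in turn, so that `x_i · y_i = 1` and the boundary of the polygon obtained by cutting
along `Ω` reads `∏ x_i⁻¹ y_i⁻¹ x_i y_i`. -/
def rot (D : DiagramData g) : D.Dart → D.Dart
  | .strand (.over c) o => .strand (.under c) (if D.sign c = 1 then o else !o)
  | .strand (.under c) o => .strand (.over c) (if D.sign c = 1 then !o else o)
  | .strand (.mark b) o => .strand (.mark b) (!o)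
  | .strand (.cut z k) o =>
      if o = decide (D.cutSign z k = 1) then .curve z k.succ true else .curve z k.castSucc false
  | .curve z j true =>
      Fin.cases (motive := fun _ => D.Dart)
        (if z.2 then .curve z.dual (Fin.last _) false else .curve z.dual 0 true)
        (fun k => .strand (.cut z k) (!decide (D.cutSign z k = 1))) j
  | .curve z j false =>
      Fin.lastCases (motive := fun _ => D.Dart)
        (if z.2 then .curve z.dual 0 true
          else .curve ((finRotate g).symm z.1, true) (Fin.last _) false)
        (fun k => .strand (.cut z k) (decide (D.cutSign z k = 1))) j

/-- Vertices of `D ∪ Ω`: orbits of the rotation. -/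
def vertexCount (D : DiagramData g) : ℕ := Nat.card (Quot fun a b : D.Dart => b = D.rot a)

/-- Edges of `D ∪ Ω`. -/
def edgeCount (D : DiagramData g) : ℕ := Nat.card (Quot fun a b : D.Dart => b = D.flip a)

/-- Boundary walks of the complementary regions of (each connected component of) `D ∪ Ω`. -/
def faceCount (D : DiagramData g) : ℕ :=
  Nat.card (Quot fun a b : D.Dart => b = D.rot (D.flip a))

/-- Connected components of `D ∪ Ω`. -/
def componentCount (D : DiagramData g) : ℕ :=
  Nat.card (Quot fun a b : D.Dart => b = D.rot a ∨ b = D.flip a)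

end DiagramData

/-- A link diagram on the closed oriented surface of genus `g`, transverse to the symplectic basis
`Ω`. The Euler characteristic condition says that the graph `D ∪ Ω` is drawn on that surface: the
component containing `Ω` has genus at least `g` and the others at least `0`, so equality means that
the first is cellularly embedded in the surface of genus `g` and that the others are planar, to be
drawn inside the regions. -/
structure LinkDiagram (g : ℕ) extends DiagramData g where
  embedded : (toDiagramData.vertexCount : ℤ) - toDiagramData.edgeCount + toDiagramData.faceCount
    = 2 * toDiagramData.componentCount - 2 * g

/-! ## The group of the link and the Carter–Silver–Williams polynomial -/

/-- `ℤ × H₁(Σ)`, written multiplicatively; `H₁(Σ)` is free abelian on `Ω`. -/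
abbrev Grading (g : ℕ) : Type := Multiplicative (ℤ × (Palette g →₀ ℤ))

/-- The group ring `ℤ[ℤ × H₁(Σ)]`. The generator of `ℤ` is written `t` or `q`. -/
abbrev Laurent (g : ℕ) : Type := MonoidAlgebra ℤ (Grading g)

/-- The generator of the factor `ℤ`. -/
def gradT (g : ℕ) : Grading g := Multiplicative.ofAdd (1, 0)

/-- The class of a basis curve. -/
def gradLoop (z : Palette g) : Grading g := Multiplicative.ofAdd (0, Finsupp.single z 1)

namespace DiagramData

variable (D : DiagramData g)

/-- Crossing into the adjacent copy of the fundamental polygon through the curve `z` acts by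
`z.dual ^ liftSign`: by `y_i ^ e` if `z = x_i` and by `x_i ^ (-e)` if `z = y_i`, where `e = D · z`.
-/
def liftSign (z : Palette g) (k : Fin (D.cuts z)) : ℤˣ :=
  if z.2 then -D.cutSign z k else D.cutSign z k

/-- The meridian of the arc leaving `p`. -/
def arcOut (p : D.Pass) : FreeGroup (D.Pass ⊕ Palette g) := FreeGroup.of (Sum.inl p)

/-- The meridian of the arc arriving at `p`. -/
def arcIn (p : D.Pass) : FreeGroup (D.Pass ⊕ Palette g) := FreeGroup.of (Sum.inl (D.next.symm p))

/-- The generator `x_i` or `y_i` of `π₁(Σ × {1}, ∞)`. -/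
def curveGen (z : Palette g) : FreeGroup (D.Pass ⊕ Palette g) := FreeGroup.of (Sum.inr z)

/-- Wirtinger relators. Along an under-passage of sign `s` below the arc `b`, the outgoing meridian
is `b ^ (-s) * a * b ^ s`; through the curve `z` it is `a ^ γ = γ * a * γ⁻¹`, with
`γ = z.dual ^ liftSign`. Products of loops are read from left to right. -/
def relator : D.Pass → FreeGroup (D.Pass ⊕ Palette g)
  | .over c => D.arcIn (.over c) * (D.arcOut (.over c))⁻¹
  | .mark b => D.arcIn (.mark b) * (D.arcOut (.mark b))⁻¹
  | .under c =>
      D.arcOut (.over c) ^ (-(D.sign c : ℤ)) * D.arcIn (.under c)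
        * D.arcOut (.over c) ^ (D.sign c : ℤ) * (D.arcOut (.under c))⁻¹
  | .cut z k =>
      D.curveGen z.dual ^ (D.liftSign z k : ℤ) * D.arcIn (.cut z k)
        * (D.curveGen z.dual ^ (D.liftSign z k : ℤ))⁻¹ * (D.arcOut (.cut z k))⁻¹

/-- `∏ [x_i, y_i]`, where `[a, b] = a⁻¹ b⁻¹ a b`. -/
def surfaceRelator : FreeGroup (D.Pass ⊕ Palette g) :=
  (List.ofFn fun i : Fin g =>
    (D.curveGen (i, false))⁻¹ * (D.curveGen (i, true))⁻¹
      * D.curveGen (i, false) * D.curveGen (i, true)).prod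

/-- All relators of the group of the link. -/
def relators : Set (FreeGroup (D.Pass ⊕ Palette g)) := Set.range D.relator ∪ {D.surfaceRelator}

/-- The fundamental group of the complement of the link in `Σ × [0,1]`, with base point on
`Σ × {1}`: the covering group of the link, a `π₁(Σ)`-operator group, together with `π₁(Σ)`, which
acts on it by conjugation. -/
abbrev LinkGroup : Type := PresentedGroup D.relators

/-- Values of the generators in `ℤ × H₁(Σ)`. -/
def gradGen : D.Pass ⊕ Palette g → Grading g
  | .inl _ => gradT g
  | .inr z => gradLoop z

theorem lift_relators : ∀ r ∈ D.relators, FreeGroup.lift D.gradGen r = 1 := by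
  rintro r (⟨p, rfl⟩ | rfl)
  · cases p <;>
      simp [relator, arcIn, arcOut, curveGen, gradGen, mul_comm, mul_assoc]
  · rw [surfaceRelator, map_list_prod, List.map_ofFn]
    apply List.prod_eq_one
    intro x hx
    obtain ⟨i, rfl⟩ := (List.mem_ofFn' _ _).1 hx
    simp [curveGen, gradGen, mul_comm, mul_assoc]

/-- The homomorphism onto the deck group `ℤ × H₁(Σ)` of the covering of the link complement: each
meridian goes to `t`, and each loop on `Σ × {1}` to its homology class. -/
def grading : D.LinkGroup →* Grading g := PresentedGroup.toGroup D.lift_relators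

/-- The image of `π₁(Σ × {1})` in the group of the link. -/
def surfaceSubgroup : Subgroup D.LinkGroup :=
  Subgroup.closure (Set.range fun z : Palette g => PresentedGroup.of (Sum.inr z))

/-- Boundaries of the bar `2`-chains `[a | b]`, and `1`-chains of `Σ × {1}`. -/
def boundaries : Submodule (Laurent g) (D.LinkGroup →₀ Laurent g) :=
  Submodule.span (Laurent g)
    ({x | ∃ a b : D.LinkGroup, x = Finsupp.single a 1
        + Finsupp.single b (MonoidAlgebra.of ℤ (Grading g) (D.grading a))
        - Finsupp.single (a * b) 1} ∪
     {x | ∃ c ∈ D.surfaceSubgroup, x = Finsupp.single c 1})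

/-- The Alexander module: the first homology of the pair formed by the covering of the link
complement with deck group `ℤ × H₁(Σ)` and the preimage of `Σ × {1}`, that is, the first homology
of the pair with coefficients in `ℤ[ℤ × H₁(Σ)]`, computed from the bar complex of the fundamental
group relative to that of the subgroup coming from `Σ × {1}`. Relative `0`-chains vanish, so every
relative `1`-chain is a cycle. -/
abbrev AlexanderModule : Type := (D.LinkGroup →₀ Laurent g) ⧸ D.boundaries

end DiagramData

/-- The zeroth order (Fitting) ideal of a finitely generated module: it is generated by the
determinants of the square matrices of relations between the members of a generating family. -/
def zerothOrderIdeal (R M : Type*) [CommRing R] [AddCommGroup M] [Module R M] : Ideal R :=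
  Ideal.span {d | ∃ (n : ℕ) (v : Fin n → M) (A : Matrix (Fin n) (Fin n) R),
    Submodule.span R (Set.range v) = ⊤ ∧ (∀ i, ∑ j, A i j • v j = 0) ∧ d = A.det}

/-- `Δ` is a (infinite cyclic) Carter–Silver–Williams polynomial of `D`: a generator of the zeroth
order ideal of the Alexander module. -/
def IsCSWPolynomial (D : LinkDiagram g) (Δ : Laurent g) : Prop :=
  zerothOrderIdeal (Laurent g) D.AlexanderModule = Ideal.span {Δ}

/-- The substitution `t ↦ q⁻²`, `x_i ↦ x_i⁻¹`, `y_i ↦ y_i⁻¹`. -/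
def substitution (g : ℕ) : Laurent g →+* Laurent g :=
  MonoidAlgebra.mapDomainRingHom ℤ
    (AddMonoidHom.toMultiplicative
      ((AddMonoidHom.mulLeft (-2 : ℤ)).prodMap (-AddMonoidHom.id (Palette g →₀ ℤ))))

/-! ## The homotopy Zh-construction

Diagrams of `Zh_Ω(D)` are written as words in elementary prismatic tangles, read from bottom to top.
Each classical crossing of `D` becomes a classical crossing. Each intersection point with a curve
`z` becomes a classical crossing of the link with an over-crossing arc coloured `z.dual`. All arcs
of a colour are joined, in an arbitrary order, to one component. All other crossings are virtual.
Strands are labelled by the arcs of the Gauss diagram they belong to. -/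

/-- Points of the coloured components: the over-crossing belonging to the `k`-th intersection point
with the curve `z`, and a marked point on the component coloured `z`. -/
inductive ColorPoint (D : DiagramData g) : Type
  | over (z : Palette g) (k : Fin (D.cuts z))
  | mark (z : Palette g)

/-- The colour of the component. -/
def ColorPoint.color {D : DiagramData g} : ColorPoint D → Palette g
  | .over z _ => z.dual
  | .mark z => z

/-- Arcs of the Gauss diagram of `Zh_Ω(D)`, named by the point which they leave: black arcs (those
of `D`) and coloured arcs. -/
abbrev Arc (D : DiagramData g) : Type := D.Pass ⊕ ColorPoint D

/-- A point of a horizontal section of a prismatic diagram: it lies on the arc `arc`, after `turns`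
local maxima and minima of this arc, on a strand oriented upwards or downwards. -/
structure SectionPoint (D : DiagramData g) where
  arc : Arc D
  turns : ℕ
  up : Bool

/-- Elementary prismatic tangles. A cup or a cap is oriented by the direction of its left end. The
strands of crossings are oriented upwards. The natural numbers are turn counts. -/
inductive Piece (D : DiagramData g) : Type
  | cup (e : Arc D) (i : ℕ) (leftUp : Bool)
  | cap (e : Arc D) (i : ℕ) (leftUp : Bool)
  | virt (e : Arc D) (i : ℕ) (f : Arc D) (j : ℕ)
  | cross (c : Fin D.crossings) (i j : ℕ)
  | colorCross (z : Palette g) (k : Fin (D.cuts z)) (i j : ℕ)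
  | mark (b : Fin D.marks) (i : ℕ)
  | colorMark (z : Palette g) (i : ℕ)

/-- Vertices of the Gauss diagram of `Zh_Ω(D)`. -/
inductive ZhVertex (D : DiagramData g) : Type
  | cross (c : Fin D.crossings)
  | colorCross (z : Palette g) (k : Fin (D.cuts z))
  | mark (b : Fin D.marks)
  | colorMark (z : Palette g)

namespace Piece

variable {D : DiagramData g}

/-- The vertex at an elementary tangle, if any. -/
def vertex : Piece D → Option (ZhVertex D)
  | .cup _ _ _ => none
  | .cap _ _ _ => none
  | .virt _ _ _ _ => none
  | .cross c _ _ => some (.cross c)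
  | .colorCross z k _ _ => some (.colorCross z k)
  | .mark b _ => some (.mark b)
  | .colorMark z _ => some (.colorMark z)

/-- The bottom of an elementary tangle. `ord` is the order of points on the coloured components.
With both strands upwards, the over-strand of a positive crossing starts on the left. -/
def dom (ord : Equiv.Perm (ColorPoint D)) : Piece D → List (SectionPoint D)
  | .cup _ _ _ => []
  | .cap e i true => [⟨e, i, true⟩, ⟨e, i + 1, false⟩]
  | .cap e i false => [⟨e, i + 1, false⟩, ⟨e, i, true⟩]
  | .virt e i f j => [⟨e, i, true⟩, ⟨f, j, true⟩]
  | .cross c i j =>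
      let o : SectionPoint D := ⟨.inl (D.next.symm (.over c)), i, true⟩
      let u : SectionPoint D := ⟨.inl (D.next.symm (.under c)), j, true⟩
      if D.sign c = 1 then [o, u] else [u, o]
  | .colorCross z k i j =>
      let o : SectionPoint D := ⟨.inr (ord.symm (.over z k)), i, true⟩
      let u : SectionPoint D := ⟨.inl (D.next.symm (.cut z k)), j, true⟩
      if D.liftSign z k = 1 then [o, u] else [u, o]
  | .mark b i => [⟨.inl (D.next.symm (.mark b)), i, true⟩]
  | .colorMark z i => [⟨.inr (ord.symm (.mark z)), i, true⟩]

/-- The top of an elementary tangle. -/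
def cod : Piece D → List (SectionPoint D)
  | .cup e i true => [⟨e, i + 1, true⟩, ⟨e, i, false⟩]
  | .cup e i false => [⟨e, i, false⟩, ⟨e, i + 1, true⟩]
  | .cap _ _ _ => []
  | .virt e i f j => [⟨f, j, true⟩, ⟨e, i, true⟩]
  | .cross c _ _ =>
      let o : SectionPoint D := ⟨.inl (.over c), 0, true⟩
      let u : SectionPoint D := ⟨.inl (.under c), 0, true⟩
      if D.sign c = 1 then [u, o] else [o, u]
  | .colorCross z k _ _ =>
      let o : SectionPoint D := ⟨.inr (.over z k), 0, true⟩
      let u : SectionPoint D := ⟨.inl (.cut z k), 0, true⟩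
      if D.liftSign z k = 1 then [u, o] else [o, u]
  | .mark b _ => [⟨.inl (.mark b), 0, true⟩]
  | .colorMark z _ => [⟨.inr (.mark z), 0, true⟩]

end Piece

/-- An elementary tangle between identity strands. -/
structure Slice (D : DiagramData g) where
  left : List (SectionPoint D)
  piece : Piece D
  right : List (SectionPoint D)

/-- The word `w` is a composable tangle from the section `a` to the section `b`. -/
def IsTangle {D : DiagramData g} (ord : Equiv.Perm (ColorPoint D)) :
    List (SectionPoint D) → List (Slice D) → List (SectionPoint D) → Prop
  | a, [], b => a = b
  | a, s :: w, b => a = s.left ++ s.piece.dom ord ++ s.right ∧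
      IsTangle ord (s.left ++ s.piece.cod ++ s.right) w b

/-- A diagram of the prismatic link `Zh_Ω(D)`, as a tangle from the empty to the empty section.
Each colour is the colour of one component, every vertex of the Gauss diagram occurs once, and by
the labels the strands join the vertices as in the Gauss diagram. (Turn counts increase along each
arc, so no further closed curve can occur.) -/
structure ZhDiagram (D : LinkDiagram g) where
  order : Equiv.Perm (ColorPoint D.toDiagramData)
  order_color : ∀ a b, order.SameCycle a b ↔ a.color = b.color
  word : List (Slice D.toDiagramData)
  closed : IsTangle order [] word []
  vertex_nodup : (word.filterMap fun s => s.piece.vertex).Nodup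
  vertex_mem : ∀ v, v ∈ word.filterMap fun s => s.piece.vertex

/-! ## The prismatic Reshetikhin–Turaev functor of the vector representation of `U_q(gl(1|1))`

`V` has the even basis vector `x₁` (written `false`) and the odd basis vector `x₂` (written `true`).
Black points of a section carry `V` if they point upwards and `V*` if they point downwards; coloured
points carry the ground ring. A basis vector of the module of a section is the list of the indices
at its black points, and all these modules are placed in the free module on lists. The values are
Laurent polynomials in `q, x_i, y_i`. -/

/-- The power `q ^ n`. -/
def qPow (g : ℕ) (n : ℤ) : Laurent g := MonoidAlgebra.single (Multiplicative.ofAdd (n, 0)) 1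

/-- The power `z ^ n` of a colour. -/
def colorPow (z : Palette g) (n : ℤ) : Laurent g :=
  MonoidAlgebra.single (Multiplicative.ofAdd (0, Finsupp.single z n)) 1

/-- The free module on lists of indices. -/
abbrev TensorSpace (g : ℕ) : Type := List Bool →₀ Laurent g

/-- A scalar multiple of a basis vector. -/
def tens (s : List Bool) (a : Laurent g) : TensorSpace g := Finsupp.single s a

/-- The value on a negative crossing. -/
def rMatrix (g : ℕ) : List Bool → TensorSpace g
  | [false, false] => tens [false, false] (qPow g 1)
  | [false, true] => tens [true, false] 1 + tens [false, true] (qPow g 1 - qPow g (-1))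
  | [true, false] => tens [false, true] 1
  | [true, true] => tens [true, true] (-qPow g (-1))
  | _ => 0

/-- The value on a positive crossing. -/
def rMatrixInv (g : ℕ) : List Bool → TensorSpace g
  | [false, false] => tens [false, false] (qPow g (-1))
  | [false, true] => tens [true, false] 1
  | [true, false] => tens [false, true] 1 + tens [true, false] (qPow g (-1) - qPow g 1)
  | [true, true] => tens [true, true] (-qPow g 1)
  | _ => 0

/-- The value on a virtual crossing of two black strands. -/
def virtMatrix (g : ℕ) : List Bool → TensorSpace g
  | [false, false] => tens [false, false] 1
  | [false, true] => tens [true, false] (qPow g (-1))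
  | [true, false] => tens [false, true] (qPow g 1)
  | [true, true] => tens [true, true] (-1)
  | _ => 0

/-- The number of black points of a section. -/
def blackCount {D : DiagramData g} (a : List (SectionPoint D)) : ℕ :=
  a.countP fun p => p.arc.isLeft

/-- The functor on elementary tangles, on basis vectors. -/
def Piece.value {D : DiagramData g} : Piece D → List Bool → TensorSpace g
  | .cup (.inl _) _ true => fun _ => tens [false, false] 1 + tens [true, true] 1
  | .cup (.inl _) _ false => fun _ =>
      tens [false, false] (qPow g (-1)) - tens [true, true] (qPow g (-1))
  | .cap (.inl _) _ true => fun s =>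
      if s = [false, false] then tens [] (qPow g 1)
      else if s = [true, true] then tens [] (-qPow g 1) else 0
  | .cap (.inl _) _ false => fun s =>
      if s = [false, false] ∨ s = [true, true] then tens [] 1 else 0
  | .virt (.inl _) _ (.inl _) _ => virtMatrix g
  | .cross c _ _ => if D.sign c = 1 then rMatrixInv g else rMatrix g
  | .colorCross z k _ _ => fun s =>
      tens s (if s = [true] then colorPow z.dual (-(D.liftSign z k : ℤ)) else 1)
  | _ => fun s => tens s 1

/-- The functor on an elementary tangle between identity strands. -/
def Slice.value {D : DiagramData g} (ord : Equiv.Perm (ColorPoint D)) (s : Slice D) :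
    TensorSpace g →ₗ[Laurent g] TensorSpace g :=
  Finsupp.linearCombination (Laurent g) fun l : List Bool =>
    let a := blackCount s.left
    let b := blackCount (s.piece.dom ord)
    Finsupp.mapDomain (fun r => l.take a ++ r ++ l.drop (a + b))
      (s.piece.value ((l.drop a).take b))

/-- The value `Q̃^{1|1}_Ω(Z)` of a diagram: the image of `1` under the composite map of the ground
ring to itself. -/
def ZhDiagram.value {D : LinkDiagram g} (Z : ZhDiagram D) : Laurent g :=
  (Z.word.foldl (fun v s => s.value Z.order v) (tens [] 1)) []

end CSW

end

/-! Both sides are, up to units, determinants of square matrices presenting one and the same module.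
Any such determinant generates the zeroth order ideal (`IsSquarePresentation.zerothOrderIdeal_eq`),
and in the domain `Laurent g` two generators of a principal ideal differ by a unit.

Alexander side. Elements `a p` of a module `N` that satisfy the Fox relations make the link group
act on `N` by affine maps: the meridian of `p` by `x ↦ t x + a p`, loops of the surface linearly.
The translation part of this action is a derivation vanishing on the surface group, so it factors
through the Alexander module. Hence every relation among the meridians is a consequence of the Fox
rows (`isSquarePresentation_alexanderModule`), and the ideal is generated by `foxMatrix.det`.

Quantum side. The values of all crossings are, up to a scalar, exterior powers of linear maps, so
the state sum can be read as a determinant. Each black strand carries a vector. A cup creates a free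
generator, carried by both of its ends; vertices and virtual crossings transform the vectors
linearly; a cap imposes the relation that its two vectors agree. In the exterior product of a
section, an upward strand contributes its vector when its index is odd, a downward strand when its
index is even. `IsDeterminantal` says that the coefficients of the partial value are, up to one
unit, those of these products times the relations so far, measured against the product `vol` of the
generators so far; `IsDeterminantal.move` propagates this through each slice. Slices that are not
black cups also receive a generator, killed at once by a relation, so that a closed word has as many
generators and relations as slices. At the end the value is a unit times the determinant of the
relations (`ZhDiagram.exists_relations`).

Identification. Dividing each vector by `q` to the Alexander index of its strand turns virtual
crossings into plain permutations. A classical crossing of sign `s` then becomes the Wirtinger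
relation with `t ^ (-s)` replaced by `q ^ (2 s)`, and a coloured crossing becomes the relation of an
intersection point with the loop inverted. These are the substituted Fox relations, so the relations
of the word present the cokernel of the substituted Fox matrix (`IsRun.isSquarePresentation`). -/

noncomputable section
namespace CSW

/-! ### Square presentations and the zeroth order ideal -/

section

open Matrix

/-- The square matrix `A` presents the module `M` on the generators `v`. -/
structure IsSquarePresentation {R M ι : Type*} [CommRing R] [AddCommGroup M] [Module R M]
    [Fintype ι] (A : Matrix ι ι R) (v : ι → M) : Prop where
  span_eq : Submodule.span R (Set.range v) = ⊤
  relation : ∀ i, ∑ j, A i j • v j = 0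
  complete : ∀ c : ι → R, ∑ j, c j • v j = 0 → ∃ y : ι → R, y ᵥ* A = c

namespace IsSquarePresentation

variable {R M ι κ : Type*} [CommRing R] [AddCommGroup M] [Module R M]
  [Fintype ι]

theorem exists_expansion {v : ι → M} (hv : Submodule.span R (Set.range v) = ⊤) (w : κ → M) :
    ∃ C : Matrix κ ι R, ∀ k, ∑ i, C k i • v i = w k := by
  have h : ∀ k, ∃ c : ι → R, ∑ i, c i • v i = w k := fun k =>
    (Submodule.mem_span_range_iff_exists_fun R).1 (hv ▸ Submodule.mem_top)
  choose C hC using h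
  exact ⟨Matrix.of C, hC⟩

theorem sum_mul_smul {κ' : Type*} [Fintype κ] (C : Matrix κ' κ R) (B : Matrix κ ι R) (v : ι → M) (i : κ') :
    ∑ j, (C * B) i j • v j = ∑ k, C i k • ∑ j, B k j • v j := by
  simp only [Matrix.mul_apply, Finset.sum_smul, Finset.smul_sum, mul_smul]
  exact Finset.sum_comm

theorem exists_left_factor {P : Matrix ι ι R} {e : ι → M} (hP : IsSquarePresentation P e)
    (B : Matrix κ ι R) (hB : ∀ k, ∑ i, B k i • e i = 0) : ∃ Y : Matrix κ ι R, Y * P = B := by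
  choose Y hY using fun k => hP.complete (B k) (hB k)
  refine ⟨Matrix.of Y, ?_⟩
  ext k i
  rw [← hY k]
  rfl

/-- Expressing each generating family through the other produces a block matrix of determinant
`A.det` that has `P` as a diagonal block of a right factor. Only `P` has to contain all relations;
`A` may be any square matrix of relations. -/
theorem det_dvd [DecidableEq ι] [Fintype κ] [DecidableEq κ] {P : Matrix ι ι R} {e : ι → M} (hP : IsSquarePresentation P e)
    {v : κ → M} {A : Matrix κ κ R} (hv : Submodule.span R (Set.range v) = ⊤)
    (hA : ∀ i, ∑ j, A i j • v j = 0) : P.det ∣ A.det := by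
  obtain ⟨C, hC⟩ := exists_expansion hP.span_eq v
  obtain ⟨B, hB⟩ := exists_expansion hv e
  obtain ⟨Y, hY⟩ := hP.exists_left_factor (A * C) (by
    intro k
    rw [sum_mul_smul]
    simp only [hC, hA])
  obtain ⟨Z, hZ⟩ := hP.exists_left_factor (1 - B * C) (by
    intro k
    simp only [Matrix.sub_apply, sub_smul, Finset.sum_sub_distrib, sum_mul_smul, hC, hB]
    simp [Matrix.one_apply])
  -- The upper right block vanishes because `A * C = Y * P`; the lower right one is the identity
  -- because `1 - B * C = Z * P`.
  have key : fromBlocks A 0 (-B) (1 : Matrix ι ι R)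
      = fromBlocks A Y (-B) Z * fromBlocks (1 : Matrix κ κ R) (-C) 0 P := by
    rw [fromBlocks_multiply]
    simp [hY, hZ]
  have h := congrArg det key
  rw [det_mul, det_fromBlocks_zero₁₂, det_fromBlocks_zero₂₁, det_one, det_one, mul_one,
    one_mul] at h
  exact ⟨_, h.trans (mul_comm _ _)⟩

theorem reindex [Fintype κ] {P : Matrix ι ι R} {e : ι → M} (hP : IsSquarePresentation P e) (f : κ ≃ ι) :
    Submodule.span R (Set.range (e ∘ f)) = ⊤ ∧
      ∀ i, ∑ j, P.submatrix f f i j • (e ∘ f) j = 0 := by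
  refine ⟨by rw [f.surjective.range_comp, hP.span_eq], fun i => ?_⟩
  simp only [submatrix_apply, Function.comp]
  rw [f.sum_comp fun j => P (f i) j • e j]
  exact hP.relation _

theorem zerothOrderIdeal_eq [DecidableEq ι] {P : Matrix ι ι R} {e : ι → M} (hP : IsSquarePresentation P e) :
    zerothOrderIdeal R M = Ideal.span {P.det} := by
  refine le_antisymm (Ideal.span_le.2 ?_) (Ideal.span_le.2 ?_)
  · rintro _ ⟨n, v, A, hv, hA, rfl⟩
    exact Ideal.mem_span_singleton.2 (hP.det_dvd hv hA)
  -- `P` itself is one of the matrices defining the ideal, once its index type is renumbered.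
  · rintro _ rfl
    obtain ⟨h₁, h₂⟩ := hP.reindex (Fintype.equivFin ι).symm
    exact Ideal.subset_span ⟨_, _, _, h₁, h₂, (det_submatrix_equiv_self _ _).symm⟩

end IsSquarePresentation

/-- A square matrix presents its cokernel. -/
theorem isSquarePresentation_quotient {R ι : Type*} [CommRing R] [Fintype ι] [DecidableEq ι]
    (A : Matrix ι ι R) :
    IsSquarePresentation A
      (fun i => (Submodule.span R (Set.range A.row)).mkQ (Pi.single i (1 : R))) := by
  have hsum : ∀ c : ι → R, ∑ j, c j • (Submodule.span R (Set.range A.row)).mkQ (Pi.single j (1 : R))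
      = (Submodule.span R (Set.range A.row)).mkQ c := by
    intro c
    conv_rhs => rw [pi_eq_sum_univ' c]
    rw [map_sum]
    refine Finset.sum_congr rfl fun j _ => ?_
    rw [← map_smul]
  refine ⟨?_, fun i => ?_, fun c hc => ?_⟩
  · rw [eq_top_iff]
    rintro x -
    obtain ⟨c, rfl⟩ := Submodule.mkQ_surjective _ x
    rw [← hsum]
    exact Submodule.sum_mem _ fun j _ => Submodule.smul_mem _ _ (Submodule.subset_span ⟨j, rfl⟩)
  · rw [hsum, Submodule.mkQ_apply, Submodule.Quotient.mk_eq_zero]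
    exact Submodule.subset_span ⟨i, rfl⟩
  · rw [hsum, Submodule.mkQ_apply, Submodule.Quotient.mk_eq_zero,
      Submodule.mem_span_range_iff_exists_fun] at hc
    obtain ⟨y, rfl⟩ := hc
    exact ⟨y, by ext i; simp [Matrix.vecMul, dotProduct]⟩

end

/-! ### Fox calculus and the presentation of the Alexander module -/

section

variable {g : ℕ}

/-- The group element `γ` as an element of the group ring. -/
def mono (γ : Grading g) : Laurent g := MonoidAlgebra.single γ 1

theorem mono_one : mono (1 : Grading g) = 1 := rfl

theorem mono_mul (γ δ : Grading g) : mono (γ * δ) = mono γ * mono δ := by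
  simp [mono, MonoidAlgebra.single_mul_single]

theorem mono_mul_inv (γ : Grading g) : mono γ * mono γ⁻¹ = 1 := by
  rw [← mono_mul, mul_inv_cancel, mono_one]

theorem mono_inv_mul (γ : Grading g) : mono γ⁻¹ * mono γ = 1 := by
  rw [← mono_mul, inv_mul_cancel, mono_one]

theorem of_eq_mono (γ : Grading g) : MonoidAlgebra.of ℤ (Grading g) γ = mono γ := rfl

/-- The affine bijection with linear part `γ` and translation part `m`. -/
def affine {N : Type*} [AddCommGroup N] [Module (Laurent g) N] (γ : Grading g) (m : N) :
    Equiv.Perm N where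
  toFun x := mono γ • x + m
  invFun x := mono γ⁻¹ • (x - m)
  left_inv x := by simp [smul_smul, mono_inv_mul]
  right_inv x := by simp [smul_smul, mono_mul_inv]

section affine
variable {N : Type*} [AddCommGroup N] [Module (Laurent g) N]

@[simp] theorem affine_apply (γ : Grading g) (m x : N) : affine γ m x = mono γ • x + m := rfl

theorem affine_one_zero : affine (1 : Grading g) (0 : N) = 1 := by
  ext x; simp [mono_one]

theorem affine_mul (γ γ' : Grading g) (m m' : N) :
    affine γ m * affine γ' m' = affine (γ * γ') (m + mono γ • m') := by
  ext x; simp [mono_mul, mul_smul]; abel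

theorem affine_inv (γ : Grading g) (m : N) :
    (affine γ m)⁻¹ = affine γ⁻¹ (-(mono γ⁻¹ • m)) := by
  rw [inv_eq_iff_mul_eq_one, affine_mul, mul_inv_cancel]
  simp [smul_smul, mono_mul_inv, affine_one_zero]

theorem affine_zpow_zero (γ : Grading g) (n : ℤ) : affine γ (0 : N) ^ n = affine (γ ^ n) 0 := by
  cases n with
  | ofNat n =>
    induction n with
    | zero => simp [affine_one_zero]
    | succ n ih =>
      simp only [Int.ofNat_eq_natCast, zpow_natCast] at ih ⊢
      rw [pow_succ, ih, affine_mul, pow_succ]; simp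
  | negSucc n =>
    have h : ∀ n : ℕ, affine γ (0 : N) ^ n = affine (γ ^ n) 0 := by
      intro n
      induction n with
      | zero => simp [affine_one_zero]
      | succ n ih => rw [pow_succ, ih, affine_mul, pow_succ]; simp
    rw [zpow_negSucc, zpow_negSucc, h, affine_inv]; simp

end affine

namespace DiagramData

/-- Passages as a sum of finite types. -/
def passEquiv (D : DiagramData g) :
    D.Pass ≃ (Fin D.crossings ⊕ Fin D.crossings) ⊕ (Σ z, Fin (D.cuts z)) ⊕ Fin D.marks where
  toFun
    | .over c => .inl (.inl c)
    | .under c => .inl (.inr c)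
    | .cut z k => .inr (.inl ⟨z, k⟩)
    | .mark b => .inr (.inr b)
  invFun
    | .inl (.inl c) => .over c
    | .inl (.inr c) => .under c
    | .inr (.inl ⟨z, k⟩) => .cut z k
    | .inr (.inr b) => .mark b
  left_inv p := by cases p <;> rfl
  right_inv p := by rcases p with (c | c) | ⟨z, k⟩ | b <;> rfl

instance (D : DiagramData g) : Fintype D.Pass := Fintype.ofEquiv _ D.passEquiv.symm

instance (D : DiagramData g) : DecidableEq D.Pass := D.passEquiv.decidableEq

variable (D : DiagramData g)

/-- Rows of the Alexander matrix: the Fox derivatives of the Wirtinger relators. -/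
def foxRow : D.Pass → D.Pass → Laurent g
  | .over c => Pi.single (D.next.symm (.over c)) 1 - Pi.single (.over c) 1
  | .mark b => Pi.single (D.next.symm (.mark b)) 1 - Pi.single (.mark b) 1
  | .under c => Pi.single (D.next.symm (.under c)) (mono (gradT g ^ (-(D.sign c : ℤ))))
      + Pi.single (.over c) (1 - mono (gradT g ^ (-(D.sign c : ℤ)))) - Pi.single (.under c) 1
  | .cut z k => Pi.single (D.next.symm (.cut z k)) (mono (gradLoop z.dual ^ (D.liftSign z k : ℤ)))
      - Pi.single (.cut z k) 1

/-- The Alexander matrix of the Wirtinger presentation, relative to the surface group. -/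
def foxMatrix : Matrix D.Pass D.Pass (Laurent g) := Matrix.of D.foxRow

/-- The relation among elements `a` indexed by the arcs that is given by a row of the Alexander
matrix with coefficients changed along `f`. -/
def FoxRelation {S N : Type*} [CommRing S] [AddCommGroup N] [Module S N] (f : Laurent g →+* S)
    (a : D.Pass → N) : D.Pass → Prop
  | .over c => a (.over c) = a (D.next.symm (.over c))
  | .mark b => a (.mark b) = a (D.next.symm (.mark b))
  | .under c => a (.under c) = f (mono (gradT g ^ (-(D.sign c : ℤ)))) • a (D.next.symm (.under c))
      + (1 - f (mono (gradT g ^ (-(D.sign c : ℤ))))) • a (.over c)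
  | .cut z k => a (.cut z k) =
      f (mono (gradLoop z.dual ^ (D.liftSign z k : ℤ))) • a (D.next.symm (.cut z k))

/-- The coefficient map `f` is kept general because two cases are needed: the identity for the
Alexander module, and the substitution for comparison with the functor. -/
theorem sum_foxMatrix_smul {S N : Type*} [CommRing S] [AddCommGroup N] [Module S N]
    (f : Laurent g →+* S) (a : D.Pass → N) (p : D.Pass) :
    ∑ r, D.foxMatrix.map f p r • a r = 0 ↔ D.FoxRelation f a p := by
  have key : ∀ (q : D.Pass) (c : Laurent g),
      ∑ r, f ((Pi.single q c : D.Pass → Laurent g) r) • a r = f c • a q := by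
    intro q c
    rw [Finset.sum_eq_single q]
    · simp
    · intro b _ hb; simp [Pi.single_eq_of_ne hb]
    · simp
  cases p <;>
    simp only [foxMatrix, Matrix.map_apply, Matrix.of_apply, foxRow, FoxRelation, Pi.sub_apply, Pi.add_apply,
      map_sub, map_add, sub_smul, add_smul, Finset.sum_sub_distrib, Finset.sum_add_distrib, key,
      map_one, one_smul] <;>
    rw [sub_eq_zero, eq_comm]

/-- Affine action of the generators of the group on a module with chosen elements. -/
def affineGen {N : Type*} [AddCommGroup N] [Module (Laurent g) N] (a : D.Pass → N) :
    D.Pass ⊕ Palette g → Equiv.Perm N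
  | .inl p => affine (gradT g) (a p)
  | .inr z => affine (gradLoop z) 0

section action
variable {D} {N : Type*} [AddCommGroup N] [Module (Laurent g) N] {a : D.Pass → N}

/-- The two sides of a Wirtinger relation have the same linear part because the grading group is
commutative; equality of their translation parts is the Fox relation. -/
theorem lift_affineGen_relator (ha : ∀ p, D.FoxRelation (RingHom.id _) a p) :
    ∀ r ∈ D.relators, FreeGroup.lift (D.affineGen a) r = 1 := by
  rintro r (⟨p, rfl⟩ | rfl)
  · have h := ha p
    rcases p with c | c | ⟨z, k⟩ | c
    · simp only [FoxRelation] at h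
      simp [relator, arcIn, arcOut, affineGen, h]
    · simp only [FoxRelation, RingHom.id_apply] at h
      rcases Int.units_eq_one_or (D.sign c) with hs | hs
      · simp only [hs, Units.val_one, zpow_neg, zpow_one] at h
        simp only [relator, hs, arcIn, arcOut, Units.val_one, zpow_neg, zpow_one, map_mul, map_inv,
          FreeGroup.lift_apply_of, affineGen]
        rw [mul_inv_eq_one, affine_inv, affine_mul, affine_mul, h]
        refine congrArg₂ affine (by simp) ?_
        simp only [inv_mul_cancel, mono_one, one_smul, sub_smul]; abel
      · simp only [hs, Units.val_neg, Units.val_one, neg_neg, zpow_one] at h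
        simp only [relator, hs, arcIn, arcOut, Units.val_neg, Units.val_one, neg_neg, zpow_one,
          map_mul, map_inv, zpow_neg, FreeGroup.lift_apply_of, affineGen]
        rw [mul_inv_eq_one, affine_inv, affine_mul, affine_mul, h]
        refine congrArg₂ affine (by simp) ?_
        · simp only [mono_mul, smul_neg, smul_smul, mul_assoc, mono_mul_inv, mul_one, sub_smul,
            one_smul]; abel
    · simp only [FoxRelation, RingHom.id_apply] at h
      simp only [relator, arcIn, arcOut, curveGen, map_mul, map_inv, map_zpow,
          FreeGroup.lift_apply_of, affineGen]
      rw [mul_inv_eq_one, affine_zpow_zero, affine_inv, affine_mul, affine_mul, h]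
      congr 1
      · simp [mul_comm]
      · simp
    · simp only [FoxRelation] at h
      simp [relator, arcIn, arcOut, affineGen, h]
  -- Loops of the surface act by multiplication with commuting monomials, so each commutator acts
  -- trivially.
  · rw [surfaceRelator, map_list_prod, List.map_ofFn]
    apply List.prod_eq_one
    intro x hx
    obtain ⟨i, rfl⟩ := (List.mem_ofFn' _ _).1 hx
    simp only [Function.comp, curveGen, map_mul, map_inv, FreeGroup.lift_apply_of, affineGen,
      affine_inv, affine_mul]
    simp [affine_one_zero, mul_comm]

/-- The affine action of the group of the link on a module with elements satisfying the relations of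
the Alexander matrix. -/
def affineAction (ha : ∀ p, D.FoxRelation (RingHom.id _) a p) : D.LinkGroup →* Equiv.Perm N :=
  PresentedGroup.toGroup (lift_affineGen_relator ha)

variable (ha : ∀ p, D.FoxRelation (RingHom.id _) a p)

/-- Linear parts multiply and agree with the grading on generators. This makes the image of `0` a
derivation over the grading. -/
theorem affineAction_eq (x : D.LinkGroup) :
    affineAction ha x = affine (D.grading x) (affineAction ha x 0) := by
  induction x using PresentedGroup.induction_on with
  | _ w =>
    induction w using FreeGroup.induction_on with
    | C1 =>
      have : PresentedGroup.mk D.relators 1 = 1 := rfl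
      simp only [this, map_one, Equiv.Perm.one_apply, affine_one_zero]
    | of y =>
      have h : affineAction ha (PresentedGroup.mk D.relators (FreeGroup.of y)) = D.affineGen a y :=
        PresentedGroup.toGroup.of _
      have h' : D.grading (PresentedGroup.mk D.relators (FreeGroup.of y)) = D.gradGen y :=
        PresentedGroup.toGroup.of _
      rw [h, h']
      cases y <;> simp [affineGen, gradGen]
    | inv_of y ih =>
      have : PresentedGroup.mk D.relators (FreeGroup.of y)⁻¹
        = (PresentedGroup.mk D.relators (FreeGroup.of y))⁻¹ := rfl
      rw [this, map_inv, map_inv, ih, affine_inv]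
      simp
    | mul y z hy hz =>
      have : PresentedGroup.mk D.relators (y * z)
        = PresentedGroup.mk D.relators y * PresentedGroup.mk D.relators z := rfl
      rw [this, map_mul, map_mul, hy, hz, affine_mul]
      simp

/-- The derivation of the group of the link with prescribed values on the meridians. -/
def derivation (x : D.LinkGroup) : N := affineAction ha x 0

theorem derivation_mul (x y : D.LinkGroup) :
    derivation ha (x * y) = derivation ha x + mono (D.grading x) • derivation ha y := by
  unfold derivation
  rw [map_mul, Equiv.Perm.mul_apply, affineAction_eq ha x]
  simp [add_comm]

theorem derivation_arc (p : D.Pass) :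
    derivation ha (PresentedGroup.of (Sum.inl p)) = a p := by
  have h : affineAction ha (PresentedGroup.of (Sum.inl p)) = D.affineGen a (.inl p) :=
    PresentedGroup.toGroup.of _
  simp [derivation, h, affineGen]

theorem derivation_surface {x : D.LinkGroup} (hx : x ∈ D.surfaceSubgroup) :
    derivation ha x = 0 := by
  have : D.surfaceSubgroup ≤ (MulAction.stabilizer (Equiv.Perm N) (0 : N)).comap
      (affineAction ha) := by
    rw [surfaceSubgroup, Subgroup.closure_le]
    rintro _ ⟨z, rfl⟩
    have h : affineAction ha (PresentedGroup.of (Sum.inr z)) = D.affineGen a (.inr z) :=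
      PresentedGroup.toGroup.of _
    simp [h, affineGen, MulAction.mem_stabilizer_iff]
  exact this hx

/-- The linear map from the Alexander module with prescribed values on the meridians. -/
def alexanderLift : D.AlexanderModule →ₗ[Laurent g] N :=
  D.boundaries.liftQ (Finsupp.linearCombination (Laurent g) (derivation ha)) (by
    rw [boundaries, Submodule.span_le]
    rintro x (⟨b, c, rfl⟩ | ⟨c, hc, rfl⟩)
    · simp only [of_eq_mono, SetLike.mem_coe, LinearMap.mem_ker, map_sub, map_add,
        Finsupp.linearCombination_single, one_smul, derivation_mul, sub_self]
    · simp [derivation_surface ha hc])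

theorem alexanderLift_single (x : D.LinkGroup) :
    alexanderLift ha (D.boundaries.mkQ (Finsupp.single x 1)) = derivation ha x := by
  simp [alexanderLift]

end action

/-- The class of the lift of a loop. -/
def chain (x : D.LinkGroup) : D.AlexanderModule := D.boundaries.mkQ (Finsupp.single x 1)

/-- The class of a meridian in the Alexander module. -/
def meridian (p : D.Pass) : D.AlexanderModule := D.chain (PresentedGroup.of (Sum.inl p))

theorem chain_mul (x y : D.LinkGroup) :
    D.chain (x * y) = D.chain x + mono (D.grading x) • D.chain y := by
  have h : D.boundaries.mkQ (Finsupp.single x 1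
        + Finsupp.single y (MonoidAlgebra.of ℤ (Grading g) (D.grading x))
        - Finsupp.single (x * y) 1) = 0 := by
    rw [Submodule.mkQ_apply, Submodule.Quotient.mk_eq_zero]
    exact Submodule.subset_span (Or.inl ⟨x, y, rfl⟩)
  rw [map_sub, map_add, sub_eq_zero] at h
  rw [chain, ← h, chain, chain, ← map_smul, of_eq_mono]
  simp

theorem chain_one : D.chain 1 = 0 := by
  have h := D.chain_mul 1 1
  rw [map_one, mono_one, one_smul, mul_one] at h
  simpa using h

theorem chain_inv (x : D.LinkGroup) : D.chain x⁻¹ = -(mono (D.grading x)⁻¹ • D.chain x) := by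
  have h := D.chain_mul x⁻¹ x
  rw [inv_mul_cancel, chain_one, map_inv] at h
  exact eq_neg_of_add_eq_zero_left h.symm

theorem chain_surface {x : D.LinkGroup} (hx : x ∈ D.surfaceSubgroup) : D.chain x = 0 := by
  rw [chain, Submodule.mkQ_apply, Submodule.Quotient.mk_eq_zero]
  exact Submodule.subset_span (Or.inr ⟨x, hx, rfl⟩)

/-- The product rule reduces the class of any word to classes of its letters, and letters from the
surface have class zero. -/
theorem span_meridian : Submodule.span (Laurent g) (Set.range D.meridian) = ⊤ := by
  have key : ∀ x, D.chain x ∈ Submodule.span (Laurent g) (Set.range D.meridian) := by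
    intro x
    induction x using PresentedGroup.induction_on with
    | _ w =>
      induction w using FreeGroup.induction_on with
      | C1 => exact D.chain_one ▸ Submodule.zero_mem _
      | of y =>
        cases y with
        | inl p => exact Submodule.subset_span ⟨p, rfl⟩
        | inr z =>
          have : D.chain (PresentedGroup.mk D.relators (FreeGroup.of (Sum.inr z))) = 0 :=
            D.chain_surface (Subgroup.subset_closure ⟨z, rfl⟩)
          exact this ▸ Submodule.zero_mem _
      | inv_of y ih =>
        have : PresentedGroup.mk D.relators (FreeGroup.of y)⁻¹
          = (PresentedGroup.mk D.relators (FreeGroup.of y))⁻¹ := rfl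
        rw [this, chain_inv]
        exact Submodule.neg_mem _ (Submodule.smul_mem _ _ ih)
      | mul y z hy hz =>
        have : PresentedGroup.mk D.relators (y * z)
          = PresentedGroup.mk D.relators y * PresentedGroup.mk D.relators z := rfl
        rw [this, chain_mul]
        exact Submodule.add_mem _ hy (Submodule.smul_mem _ _ hz)
  rw [eq_top_iff]
  rintro x -
  obtain ⟨x, rfl⟩ := Submodule.mkQ_surjective _ x
  induction x using Finsupp.induction_linear with
  | zero => simp
  | add x y hx hy => rw [map_add]; exact Submodule.add_mem _ hx hy
  | single x r =>
    rw [← mul_one r, ← smul_eq_mul, ← Finsupp.smul_single, map_smul]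
    exact Submodule.smul_mem _ _ (key x)

theorem relator_eq_one (p : D.Pass) : PresentedGroup.mk D.relators (D.relator p) = 1 :=
  PresentedGroup.one_of_mem (Or.inl ⟨p, rfl⟩)

theorem grading_arc (p : D.Pass) :
    D.grading (PresentedGroup.mk D.relators (FreeGroup.of (Sum.inl p))) = gradT g :=
  PresentedGroup.toGroup.of _

theorem grading_curve (z : Palette g) :
    D.grading (PresentedGroup.mk D.relators (FreeGroup.of (Sum.inr z))) = gradLoop z :=
  PresentedGroup.toGroup.of _

/-- The product rule for `chain`, applied to both sides of a Wirtinger relation. -/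
theorem foxRelation_meridian (p : D.Pass) : D.FoxRelation (RingHom.id _) D.meridian p := by
  have h := D.relator_eq_one p
  have hm : ∀ p, D.chain (PresentedGroup.mk D.relators (FreeGroup.of (Sum.inl p))) = D.meridian p :=
    fun p => rfl
  rcases p with c | c | ⟨z, k⟩ | c
  · simp only [relator, arcIn, arcOut, map_mul, map_inv, mul_inv_eq_one] at h
    simp only [FoxRelation, ← hm, h]
  · simp only [relator, arcIn, arcOut, map_mul, map_inv, map_zpow, mul_inv_eq_one] at h
    simp only [FoxRelation, ← hm, ← h, RingHom.id_apply]
    rcases Int.units_eq_one_or (D.sign c) with hs | hs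
    · simp only [hs, Units.val_one, zpow_neg, zpow_one, chain_mul, chain_inv, map_mul, map_inv,
        grading_arc]
      simp [mono_one, sub_smul]; abel
    · simp only [hs, Units.val_one, Units.val_neg, neg_neg, zpow_neg, zpow_one, chain_mul,
        chain_inv, map_mul, grading_arc]
      simp only [mono_mul, smul_neg, smul_smul, mul_assoc, mono_mul_inv, mul_one, sub_smul,
        one_smul]; abel
  · simp only [relator, arcIn, arcOut, curveGen, map_mul, map_inv, map_zpow, mul_inv_eq_one] at h
    have hs : ∀ n : ℤ,
        D.chain (PresentedGroup.mk D.relators (FreeGroup.of (Sum.inr z.dual)) ^ n) = 0 := fun n =>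
      D.chain_surface (D.surfaceSubgroup.zpow_mem (Subgroup.subset_closure ⟨z.dual, rfl⟩) n)
    simp only [FoxRelation, ← hm, ← h, RingHom.id_apply, chain_mul, chain_inv, hs, map_zpow,
      grading_curve]
    simp
  · simp only [relator, arcIn, arcOut, map_mul, map_inv, mul_inv_eq_one] at h
    simp only [FoxRelation, ← hm, h]

theorem isSquarePresentation_alexanderModule :
    IsSquarePresentation D.foxMatrix D.meridian := by
  have hmap : D.foxMatrix.map (RingHom.id (Laurent g)) = D.foxMatrix := by ext; rfl
  refine ⟨D.span_meridian, fun p => ?_, fun c hc => ?_⟩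
  · have := (D.sum_foxMatrix_smul (RingHom.id _) D.meridian p).2 (D.foxRelation_meridian p)
    rwa [hmap] at this
  · have hq := isSquarePresentation_quotient D.foxMatrix
    have ha : ∀ p, D.FoxRelation (RingHom.id _) (fun i =>
        (Submodule.span (Laurent g) (Set.range D.foxMatrix.row)).mkQ (Pi.single i 1)) p := by
      intro p
      rw [← sum_foxMatrix_smul, hmap]
      exact hq.relation p
    -- A relation among the meridians is carried by `alexanderLift` to the cokernel of the Fox
    -- matrix, where meridians become classes of basis vectors; its coefficient vector is therefore
    -- a combination of Fox rows.
    apply hq.complete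
    have := congrArg (alexanderLift ha) hc
    rw [map_zero, map_sum] at this
    rw [← this]
    refine Finset.sum_congr rfl fun p _ => ?_
    rw [map_smul, meridian, chain, alexanderLift_single, derivation_arc]

theorem zerothOrderIdeal_alexanderModule :
    zerothOrderIdeal (Laurent g) D.AlexanderModule = Ideal.span {D.foxMatrix.det} :=
  D.isSquarePresentation_alexanderModule.zerothOrderIdeal_eq

end DiagramData

end

/-! ### Local maps between tensor powers -/

section

variable {g : ℕ}

/-- The lists of `n` indices. -/
def boolLists (n : ℕ) : Finset (List Bool) :=
  (Finset.univ : Finset (Fin n → Bool)).image List.ofFn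

theorem mem_boolLists {n : ℕ} {l : List Bool} : l ∈ boolLists n ↔ l.length = n := by
  simp only [boolLists, Finset.mem_image, Finset.mem_univ, true_and]
  constructor
  · rintro ⟨f, rfl⟩
    simp
  · rintro rfl
    exact ⟨l.get, List.ofFn_get l⟩

theorem boolLists_zero : boolLists 0 = {[]} := by
  ext l; simp [mem_boolLists]

theorem boolLists_one : boolLists 1 = {[false], [true]} := by
  ext l
  rw [mem_boolLists, List.length_eq_one_iff]
  simp

theorem boolLists_two : boolLists 2 =
    {[false, false], [false, true], [true, false], [true, true]} := by
  ext l
  rw [mem_boolLists, List.length_eq_two]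
  simp only [Finset.mem_insert, Finset.mem_singleton]
  constructor
  · rintro ⟨a, b, rfl⟩
    cases a <;> cases b <;> simp
  · rintro (h | h | h | h) <;> exact ⟨_, _, h⟩

/-- A local map `val` between tensor powers, applied after the first `a` factors, to `b` factors. -/
def insertMap (a b : ℕ) (val : List Bool → TensorSpace g) :
    TensorSpace g →ₗ[Laurent g] TensorSpace g :=
  Finsupp.linearCombination (Laurent g) fun l : List Bool =>
    Finsupp.mapDomain (fun r => l.take a ++ r ++ l.drop (a + b)) (val ((l.drop a).take b))

section insertMap

variable {a b c b' : ℕ} {val : List Bool → TensorSpace g} {v : TensorSpace g}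

theorem insertMap_apply (hv : ∀ l, v l ≠ 0 → l.length = a + b + c) (l' : List Bool) :
    insertMap a b val v l' = ∑ l ∈ boolLists (a + b + c), v l *
      (Finsupp.mapDomain (fun r => l.take a ++ r ++ l.drop (a + b))
        (val ((l.drop a).take b))) l' := by
  rw [insertMap, Finsupp.linearCombination_apply,
    Finsupp.sum_of_support_subset (s := boolLists (a + b + c)), Finsupp.finsetSum_apply]
  · rfl
  · intro l hl
    exact mem_boolLists.2 (hv l (Finsupp.mem_support_iff.1 hl))
  · simp

theorem exists_of_mapDomain_ne_zero {l₁ l₂ : List Bool} {f : TensorSpace g} {l' : List Bool}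
    (h : Finsupp.mapDomain (fun r => l₁ ++ r ++ l₂) f l' ≠ 0) :
    ∃ r, l' = l₁ ++ r ++ l₂ ∧ f r ≠ 0 := by
  have hinj : Function.Injective fun r => l₁ ++ r ++ l₂ := by
    intro r s hrs
    simpa using hrs
  by_cases hr : l' ∈ Set.range fun r => l₁ ++ r ++ l₂
  · obtain ⟨r, rfl⟩ := hr
    rw [Finsupp.mapDomain_apply hinj] at h
    exact ⟨r, rfl, h⟩
  · exact absurd (Finsupp.mapDomain_of_notMem_range _ _ hr) h

theorem exists_of_insertMap_ne_zero (hv : ∀ l, v l ≠ 0 → l.length = a + b + c) {l' : List Bool}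
    (h : insertMap a b val v l' ≠ 0) :
    ∃ l₁ m m' l₂, l₁.length = a ∧ m.length = b ∧ l₂.length = c ∧ l' = l₁ ++ m' ++ l₂ ∧
      v (l₁ ++ m ++ l₂) ≠ 0 ∧ val m m' ≠ 0 := by
  rw [insertMap_apply hv] at h
  obtain ⟨l, hl, hne⟩ := Finset.exists_ne_zero_of_sum_ne_zero h
  rw [mem_boolLists] at hl
  obtain ⟨r, rfl, hr⟩ := exists_of_mapDomain_ne_zero (right_ne_zero_of_mul hne)
  refine ⟨l.take a, (l.drop a).take b, r, l.drop (a + b), ?_, ?_, ?_, rfl, ?_, hr⟩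
  · simp; omega
  · simp; omega
  · simp; omega
  · have : l.take a ++ (l.drop a).take b ++ l.drop (a + b) = l := by
      rw [← List.take_add, List.take_append_drop]
    rw [this]
    exact left_ne_zero_of_mul hne

/-- When all outputs have the length of `m'`, the splitting of the target list into three parts is
unique, so only basis vectors agreeing with it on both sides of the local map contribute. -/
theorem insertMap_append (hv : ∀ l, v l ≠ 0 → l.length = a + b + c)
    {l₁ m' l₂ : List Bool} (h₁ : l₁.length = a) (h₂ : l₂.length = c)
    (hval : ∀ m, m.length = b → ∀ r, val m r ≠ 0 → r.length = m'.length) :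
    insertMap a b val v (l₁ ++ m' ++ l₂) =
      ∑ m ∈ boolLists b, v (l₁ ++ m ++ l₂) * val m m' := by
  classical
  have hinj : ∀ l₁ l₂ : List Bool, Function.Injective fun r => l₁ ++ r ++ l₂ := by
    intro l₁ l₂ r s hrs
    simpa using hrs
  rw [insertMap_apply hv]
  have hsub : (boolLists b).image (fun m => l₁ ++ m ++ l₂) ⊆ boolLists (a + b + c) := by
    intro l hl
    obtain ⟨m, hm, rfl⟩ := Finset.mem_image.1 hl
    rw [mem_boolLists] at hm ⊢
    simp only [List.length_append]; omega
  rw [← Finset.sum_subset hsub]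
  · rw [Finset.sum_image fun x _ y _ h => hinj l₁ l₂ h]
    refine Finset.sum_congr rfl fun m hm => ?_
    rw [mem_boolLists] at hm
    subst h₁ hm
    have e₁ : (l₁ ++ m ++ l₂).take l₁.length = l₁ := by simp
    have e₂ : (l₁ ++ m ++ l₂).drop (l₁.length + m.length) = l₂ := by
      rw [← List.length_append, List.drop_left]
    have e₃ : ((l₁ ++ m ++ l₂).drop l₁.length).take m.length = m := by simp
    rw [e₁, e₂, e₃, Finsupp.mapDomain_apply (hinj l₁ l₂)]
  · intro l hl hl'
    by_contra hne
    rw [mem_boolLists] at hl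
    obtain ⟨r, hr, hr'⟩ := exists_of_mapDomain_ne_zero (right_ne_zero_of_mul hne)
    have hlen : r.length = m'.length := hval _ (by simp; omega) r hr'
    have hta : (l.take a).length = l₁.length := by simp; omega
    rw [List.append_assoc, List.append_assoc] at hr
    obtain ⟨e₁, e₂⟩ := List.append_inj hr hta.symm
    obtain ⟨-, e₃⟩ := List.append_inj e₂ hlen.symm
    apply hl'
    refine Finset.mem_image.2 ⟨(l.drop a).take b, mem_boolLists.2 (by simp; omega), ?_⟩
    rw [e₁, e₃, ← List.take_add, List.take_append_drop]

theorem insertMap_id (a b : ℕ) (v : TensorSpace g) : insertMap a b (fun s => tens s 1) v = v := by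
  have : insertMap a b (fun s : List Bool => (tens s 1 : TensorSpace g)) = LinearMap.id := by
    ext l : 1
    apply LinearMap.ext_ring
    simp only [insertMap, LinearMap.comp_apply, Finsupp.lsingle_apply,
      Finsupp.linearCombination_single, one_smul, tens, Finsupp.mapDomain_single, LinearMap.id_apply]
    rw [← List.take_add, List.take_append_drop]
  rw [this, LinearMap.id_apply]

end insertMap

/-! ### Exterior products of sections and the determinantal form of the state sum -/

/-- A black point of a section: the arc to which it belongs, the number of turns of the arc before
it, its direction, the Alexander index of the region to its left, and a vector of a module: the
image of the cups under transport along upward strands if it points upwards, the generator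
belonging to its cup if it points downwards. -/
structure Strand (D : DiagramData g) (F : Type*) where
  arc : D.Pass
  turns : ℕ
  up : Bool
  idx : ℤ
  vec : F

/-- The sign of the parity of the number of odd factors. -/
def paritySign (g : ℕ) (l : List Bool) : Laurent g := (-1) ^ l.count true

@[simp] theorem paritySign_nil : paritySign g [] = 1 := by simp [paritySign]
@[simp] theorem paritySign_true (l : List Bool) : paritySign g (true :: l) = -paritySign g l := by
  simp [paritySign, pow_succ]
@[simp] theorem paritySign_false (l : List Bool) : paritySign g (false :: l) = paritySign g l := by
  simp [paritySign]

theorem paritySign_append (l m : List Bool) :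
    paritySign g (l ++ m) = paritySign g l * paritySign g m := by
  simp [paritySign, pow_add]

theorem paritySign_mul_self (l : List Bool) : paritySign g l * paritySign g l = 1 := by
  rw [paritySign, ← mul_pow]; simp

section wedge

variable {D : DiagramData g} {F : Type*}

/-- Number of downward strands. -/
def downs (S : List (Strand D F)) : ℕ := S.countP fun s => !s.up

/-- Upward minus downward odd factors. -/
def charge : List (Strand D F) → List Bool → ℤ
  | s :: S, b :: l => (if b then if s.up then 1 else -1 else 0) + charge S l
  | _, _ => 0

theorem charge_cons (s : Strand D F) (S : List (Strand D F)) (b : Bool) (l : List Bool) :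
    charge (s :: S) (b :: l) = (if b then if s.up then 1 else -1 else 0) + charge S l := rfl

theorem downs_cons (s : Strand D F) (S : List (Strand D F)) :
    downs (s :: S) = downs S + if s.up then 0 else 1 := by
  cases h : s.up <;> simp [downs, h]

theorem charge_append {S : List (Strand D F)} {l : List Bool} (h : l.length = S.length)
    (T : List (Strand D F)) (m : List Bool) :
    charge (S ++ T) (l ++ m) = charge S l + charge T m := by
  induction S generalizing l with
  | nil => cases List.length_eq_zero_iff.1 h; simp [charge]
  | cons s S ih =>
    obtain _ | ⟨b, l⟩ := l
    · simp at h
    · rw [List.cons_append, List.cons_append, charge_cons, charge_cons, ih (by simpa using h)]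
      ring

/-- Direction does not matter modulo two. Conservation of charge therefore implies conservation of
the parity that governs the signs. -/
theorem paritySign_eq_charge {S : List (Strand D F)} {l : List Bool} (h : l.length = S.length) :
    paritySign g l = (((-1 : ℤˣ) ^ charge S l : ℤˣ) : ℤ) := by
  induction S generalizing l with
  | nil => cases List.length_eq_zero_iff.1 h; simp [charge]
  | cons s S ih =>
    obtain _ | ⟨b, l⟩ := l
    · simp at h
    · have := ih (by simpa using h)
      cases b
      · simp [charge_cons, this]
      · cases hs : s.up <;> simp [charge_cons, this, zpow_add, hs]

theorem length_split {A M' B : List (Strand D F)} {l : List Bool} (h : l.length = (A ++ M' ++ B).length) :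
    ∃ l₁ m' l₂, l = l₁ ++ m' ++ l₂ ∧ l₁.length = A.length ∧ m'.length = M'.length ∧
      l₂.length = B.length := by
  simp only [List.length_append] at h
  refine ⟨l.take A.length, (l.drop A.length).take M'.length, l.drop (A.length + M'.length), ?_,
    ?_, ?_, ?_⟩
  · rw [← List.take_add, List.take_append_drop]
  · simp; omega
  · simp; omega
  · simp; omega

variable [AddCommGroup F] [Module (Laurent g) F]

/-- The factor of a strand with index `b`, when `l` are the indices to the right of it. -/
def Strand.factor (s : Strand D F) (b : Bool) (l : List Bool) : ExteriorAlgebra (Laurent g) F :=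
  if s.up then if b then ExteriorAlgebra.ι (Laurent g) s.vec else 1
  else -(paritySign g l) • if b then 1 else ExteriorAlgebra.ι (Laurent g) s.vec

/-- The exterior product belonging to a basis vector of a section. -/
def wedge : List (Strand D F) → List Bool → ExteriorAlgebra (Laurent g) F
  | [], [] => 1
  | s :: S, b :: l => s.factor b l * wedge S l
  | _, _ => 0

theorem wedge_nil : wedge ([] : List (Strand D F)) [] = 1 := rfl
theorem wedge_cons (s : Strand D F) (S : List (Strand D F)) (b : Bool) (l : List Bool) :
    wedge (s :: S) (b :: l) = s.factor b l * wedge S l := rfl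

/-- Only the factor of a downward strand sees the indices to its right, so each downward strand of
`S` picks up the sign of `m` once. -/
theorem wedge_append {S : List (Strand D F)} {l : List Bool} (h : l.length = S.length)
    (T : List (Strand D F)) (m : List Bool) :
    wedge (S ++ T) (l ++ m) = paritySign g m ^ downs S • (wedge S l * wedge T m) := by
  induction S generalizing l with
  | nil => cases List.length_eq_zero_iff.1 h; simp [wedge, downs]
  | cons s S ih =>
    obtain _ | ⟨b, l⟩ := l
    · simp at h
    · rw [List.cons_append, List.cons_append, wedge_cons, wedge_cons, ih (by simpa using h),
        downs_cons]
      cases hs : s.up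
      · simp only [Strand.factor, hs, paritySign_append, Bool.false_eq_true, if_false, pow_add,
          pow_one, mul_smul_comm, smul_mul_assoc, smul_smul, mul_assoc]
        congr 1; ring
      · simp [Strand.factor, hs, mul_assoc]

theorem ι_mul_ι (x y : F) : ExteriorAlgebra.ι (Laurent g) x * ExteriorAlgebra.ι (Laurent g) y
    = -(ExteriorAlgebra.ι (Laurent g) y * ExteriorAlgebra.ι (Laurent g) x) :=
  eq_neg_of_add_eq_zero_left (ExteriorAlgebra.ι_add_mul_swap x y)

/-- The degree of the product is the charge plus the number of downward strands; modulo two the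
charge counts the odd indices. -/
theorem wedge_mul_ι {S : List (Strand D F)} {l : List Bool} (h : l.length = S.length) (x : F) :
    wedge S l * ExteriorAlgebra.ι (Laurent g) x
      = (paritySign g l * (-1) ^ downs S) • (ExteriorAlgebra.ι (Laurent g) x * wedge S l) := by
  induction S generalizing l with
  | nil => cases List.length_eq_zero_iff.1 h; simp [wedge, downs]
  | cons s S ih =>
    obtain _ | ⟨b, l⟩ := l
    · simp at h
    · rw [wedge_cons, mul_assoc, ih (by simpa using h), downs_cons]
      cases hs : s.up <;> cases b <;>
        simp only [Strand.factor, hs, Bool.false_eq_true, if_false, if_true, pow_add, pow_one,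
          paritySign_true, paritySign_false, mul_smul_comm, smul_mul_assoc, smul_smul, one_mul,
          add_zero, ← mul_assoc]
      · rw [ι_mul_ι, neg_mul, smul_neg, ← neg_smul]; congr 1; ring
      · congr 1; ring
      · rw [ι_mul_ι, neg_mul, smul_neg, ← neg_smul]; congr 1; ring

/-- The exterior product of a list of vectors. -/
def wedgeList (C : List F) : ExteriorAlgebra (Laurent g) F :=
  (C.map (ExteriorAlgebra.ι (Laurent g))).prod

theorem wedgeList_mul_ι (C : List F) (x : F) :
    wedgeList (g := g) C * ExteriorAlgebra.ι (Laurent g) x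
      = (-1 : Laurent g) ^ C.length • (ExteriorAlgebra.ι (Laurent g) x * wedgeList C) := by
  induction C with
  | nil => simp [wedgeList]
  | cons c C ih =>
    have : wedgeList (g := g) (c :: C) = ExteriorAlgebra.ι (Laurent g) c * wedgeList C := by
      simp [wedgeList]
    rw [this, mul_assoc, ih, mul_smul_comm, ← mul_assoc, ι_mul_ι, List.length_cons, pow_succ,
      mul_smul, neg_mul, mul_assoc, neg_smul, one_smul]

/-- The coefficients of `v` are, up to a common unit, the coefficients in which the exterior
products of the section `S` and of the relations `C` are multiples of `vol`. -/
def IsDeterminantal (S : List (Strand D F)) (C : List F) (vol : ExteriorAlgebra (Laurent g) F)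
    (v : TensorSpace g) : Prop :=
  (∀ l, v l ≠ 0 → l.length = S.length ∧ charge S l = 0) ∧
    ∃ u : (Laurent g)ˣ, ∀ l, l.length = S.length → 0 ≤ charge S l →
      v l • vol = (u : Laurent g) • (wedge S l * wedgeList C)

variable {A M M' B : List (Strand D F)} {C : List F} {vol : ExteriorAlgebra (Laurent g) F}
  {v : TensorSpace g} {val : List Bool → TensorSpace g}

/-- The local map `val` preserves lengths and charges. -/
def Conserves (M M' : List (Strand D F)) (val : List Bool → TensorSpace g) : Prop :=
  ∀ m, m.length = M.length → ∀ m', val m m' ≠ 0 → m'.length = M'.length ∧ charge M' m' = charge M m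

theorem IsDeterminantal.support (h : IsDeterminantal (A ++ M ++ B) C vol v)
    (hc : Conserves M M' val) (l : List Bool)
    (hl : insertMap A.length M.length val v l ≠ 0) :
    l.length = (A ++ M' ++ B).length ∧ charge (A ++ M' ++ B) l = 0 := by
  obtain ⟨l₁, m, m', l₂, h₁, hm, h₂, rfl, hv, hval⟩ := exists_of_insertMap_ne_zero (c := B.length)
    (fun l hl => by rw [(h.1 l hl).1]; simp; try omega) hl
  obtain ⟨e₁, e₂⟩ := hc m hm m' hval
  have := (h.1 _ hv).2
  rw [List.append_assoc, List.append_assoc, charge_append h₁, charge_append hm] at this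
  rw [List.append_assoc, List.append_assoc, charge_append h₁, charge_append e₁, e₂, this]
  simp [h₁, h₂, e₁]

/-- The effect of a local map on the exterior products is confined to the middle factor: the signs
of `wedge_append` depend on `m` only through its parity, which conservation of charge ties to that
of `m'`, so they come out of the sum. -/
theorem IsDeterminantal.exists_expansion (h : IsDeterminantal (A ++ M ++ B) C vol v)
    (hc : Conserves M M' val) : ∃ u : (Laurent g)ˣ, ∀ l₁ m' l₂, l₁.length = A.length →
      m'.length = M'.length → l₂.length = B.length →
      0 ≤ charge (A ++ M' ++ B) (l₁ ++ m' ++ l₂) →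
      insertMap A.length M.length val v (l₁ ++ m' ++ l₂) • vol =
        ((u : Laurent g) * ((paritySign g m' * paritySign g l₂) ^ downs A *
          paritySign g l₂ ^ downs M)) •
          (wedge A l₁ * (∑ m ∈ boolLists M.length, val m m' • wedge M m) * wedge B l₂
            * wedgeList C) := by
  obtain ⟨hs, u, hu⟩ := h
  refine ⟨u, fun l₁ m' l₂ h₁ hm' h₂ hch => ?_⟩
  rw [insertMap_append (c := B.length) (fun l hl => by rw [(hs l hl).1]; simp; try omega) h₁ h₂
    (fun m hm r hr => (hc m hm r hr).1.trans hm'.symm), Finset.sum_smul, Finset.mul_sum,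
    Finset.sum_mul, Finset.sum_mul, Finset.smul_sum]
  refine Finset.sum_congr rfl fun m hm => ?_
  rw [mem_boolLists] at hm
  by_cases hval : val m m' = 0
  · simp [hval]
  obtain ⟨-, hcm⟩ := hc m hm m' hval
  have hps : paritySign g m = paritySign g m' := by
    rw [paritySign_eq_charge hm, paritySign_eq_charge hm', hcm]
  have hlen : (l₁ ++ m ++ l₂).length = (A ++ M ++ B).length := by simp [h₁, h₂, hm]
  have hch' : 0 ≤ charge (A ++ M ++ B) (l₁ ++ m ++ l₂) := by
    rwa [List.append_assoc, List.append_assoc, charge_append h₁, charge_append hm, ← hcm,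
      ← charge_append hm', ← charge_append h₁, ← List.append_assoc, ← List.append_assoc]
  rw [mul_comm, mul_smul, hu _ hlen hch', List.append_assoc, List.append_assoc, wedge_append h₁,
    wedge_append hm, paritySign_append, hps]
  simp only [mul_smul_comm, smul_mul_assoc, smul_smul, mul_assoc]
  congr 1; ring

theorem wedge_append_append {l₁ m' : List Bool} (h₁ : l₁.length = A.length)
    (hm : m'.length = M'.length) (l₂ : List Bool) :
    wedge (A ++ M' ++ B) (l₁ ++ m' ++ l₂) =
      ((paritySign g m' * paritySign g l₂) ^ downs A * paritySign g l₂ ^ downs M') •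
        (wedge A l₁ * wedge M' m' * wedge B l₂) := by
  rw [List.append_assoc, List.append_assoc, wedge_append h₁, wedge_append hm, paritySign_append,
    mul_smul_comm, smul_smul, mul_assoc]

theorem wedgeList_append_singleton (C : List F) (δ : F) :
    wedgeList (g := g) (C ++ [δ]) = wedgeList C * ExteriorAlgebra.ι (Laurent g) δ := by
  simp [wedgeList]

/-- A vertex or a virtual crossing of upward strands. -/
theorem IsDeterminantal.vertex (h : IsDeterminantal (A ++ M ++ B) C vol v)
    (hc : Conserves M M' val) (hM : downs M = 0) (hM' : downs M' = 0) (κ : (Laurent g)ˣ)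
    (hκ : ∀ m', m'.length = M'.length →
      ∑ m ∈ boolLists M.length, val m m' • wedge M m = (κ : Laurent g) • wedge M' m') (δ : F) :
    IsDeterminantal (A ++ M' ++ B) (C ++ [δ]) (vol * ExteriorAlgebra.ι (Laurent g) δ)
      (insertMap A.length M.length val v) := by
  refine ⟨h.support hc, ?_⟩
  obtain ⟨u, hu⟩ := h.exists_expansion hc
  refine ⟨u * κ, fun l hl hch => ?_⟩
  obtain ⟨l₁, m', l₂, rfl, h₁, hm', h₂⟩ := length_split hl
  rw [← smul_mul_assoc, hu l₁ m' l₂ h₁ hm' h₂ hch, hκ m' hm', wedge_append_append h₁ hm', hM, hM',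
    wedgeList_append_singleton, Units.val_mul]
  simp only [mul_smul_comm, smul_mul_assoc, smul_smul, mul_assoc]
  congr 1; ring

/-- A local minimum, with generator `δ`. -/
theorem IsDeterminantal.minimum (h : IsDeterminantal (A ++ [] ++ B) C vol v)
    (hc : Conserves [] M' val) (hM' : downs M' = 1) (κ : (Laurent g)ˣ) (δ : F)
    (hneg : ∀ m', m'.length = M'.length → charge M' m' < 0 →
      ∃ c : Laurent g, wedge M' m' = c • 1)
    (hκ : ∀ m', m'.length = M'.length → 0 ≤ charge M' m' →
      val [] m' • ExteriorAlgebra.ι (Laurent g) δ = (κ : Laurent g) • wedge M' m') :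
    IsDeterminantal (A ++ M' ++ B) C (vol * ExteriorAlgebra.ι (Laurent g) δ)
      (insertMap A.length 0 val v) := by
  refine ⟨h.support hc, ?_⟩
  obtain ⟨u, hu⟩ := h.exists_expansion hc
  -- The signs come from moving `δ` from the end, past the relations `C` and the strands `B`, to the
  -- place of the new minimum. The remaining sign of `l₂` is the one contributed by the new downward
  -- strand.
  refine ⟨u * κ * ((-1) ^ C.length * (-1) ^ downs B), fun l hl hch => ?_⟩
  obtain ⟨l₁, m', l₂, rfl, h₁, hm', h₂⟩ := length_split hl
  have hu' := hu l₁ m' l₂ h₁ hm' h₂ hch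
  rw [List.length_nil, boolLists_zero, Finset.sum_singleton, wedge_nil] at hu'
  rw [← smul_mul_assoc, hu', wedge_append_append h₁ hm', hM']
  -- If the two new strands have negative charge, the old strands have positive charge. Their
  -- exterior product with the relations must then vanish, which is why `IsDeterminantal` also
  -- covers indices of positive charge.
  rcases lt_or_ge (charge M' m') 0 with hlt | hch'
  · obtain ⟨c, hcc⟩ := hneg m' hm' hlt
    have h0 : val [] m' = 0 := by
      by_contra h0
      rw [(hc [] rfl m' h0).2] at hlt
      exact lt_irrefl _ hlt
    have hX : wedge A l₁ * (wedge B l₂ * wedgeList C) = 0 := by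
      obtain ⟨hs, w, hw⟩ := h
      have hpos : 0 < charge (A ++ [] ++ B) (l₁ ++ [] ++ l₂) := by
        rw [List.append_assoc, List.append_assoc, charge_append h₁, charge_append hm'] at hch
        rw [List.append_assoc, List.append_assoc, charge_append h₁, List.nil_append, List.nil_append]
        omega
      have h1 := hw (l₁ ++ [] ++ l₂) (by simp [h₁, h₂]) hpos.le
      have h2 : v (l₁ ++ [] ++ l₂) = 0 := by
        by_contra h2
        exact hpos.ne' (hs _ h2).2
      rw [h2, zero_smul, wedge_append_append h₁ rfl, wedge_nil, mul_one, smul_mul_assoc, smul_smul,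
        mul_assoc] at h1
      -- Multiplying by the inverse unit and by the same sign again leaves the bare product.
      have h3 := congrArg (fun x => (((w⁻¹ : (Laurent g)ˣ) : Laurent g) *
        paritySign g l₂ ^ downs A) • x) h1
      simp only [smul_zero, smul_smul, downs, List.countP_nil, pow_zero, mul_one, paritySign_nil,
        one_mul] at h3
      rw [show ∀ p : Laurent g, ((w⁻¹ : (Laurent g)ˣ) : Laurent g) * p * (w * p) = p * p from
        fun p => by linear_combination (p * p) * w.inv_mul, ← mul_pow, paritySign_mul_self, one_pow,
        one_smul] at h3
      exact h3.symm
    rw [h0, hcc]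
    simp only [zero_smul, mul_zero, zero_mul, smul_zero, mul_smul_comm, smul_mul_assoc, mul_one,
      mul_assoc, hX]
  calc _ = ((u : Laurent g) * ((paritySign g m' * paritySign g l₂) ^ downs A) *
        ((-1) ^ C.length * (-1) ^ downs B * paritySign g l₂)) •
        (wedge A l₁ * (val [] m' • ExteriorAlgebra.ι (Laurent g) δ) * wedge B l₂
          * wedgeList C) := by
        simp only [mul_assoc, smul_mul_assoc, wedgeList_mul_ι, mul_smul_comm, smul_smul, one_mul]
        rw [← mul_assoc (wedge B l₂), wedge_mul_ι h₂]
        simp only [mul_assoc, smul_mul_assoc, mul_smul_comm, smul_smul, downs, List.countP_nil,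
          pow_zero, one_mul]
        congr 1; ring
    _ = _ := by
        rw [hκ m' hm' hch']
        simp only [mul_smul_comm, smul_mul_assoc, smul_smul, mul_assoc, Units.val_mul,
          Units.val_pow_eq_pow_val, Units.val_neg, Units.val_one, pow_one]
        congr 1; ring

/-- A local maximum, with relation `ρ`. -/
theorem IsDeterminantal.maximum (h : IsDeterminantal (A ++ M ++ B) C vol v)
    (hc : Conserves M [] val) (hM : downs M = 1) (κ : (Laurent g)ˣ) (δ ρ : F)
    (hκ : ∑ m ∈ boolLists M.length, val m [] • wedge M m
      = (κ : Laurent g) • ExteriorAlgebra.ι (Laurent g) ρ) :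
    IsDeterminantal (A ++ [] ++ B) (ρ :: C ++ [δ]) (vol * ExteriorAlgebra.ι (Laurent g) δ)
      (insertMap A.length M.length val v) := by
  refine ⟨h.support hc, ?_⟩
  obtain ⟨u, hu⟩ := h.exists_expansion hc
  -- The new relation stands first among the relations, so `ρ` has only to be moved past the strands
  -- `B`.
  refine ⟨u * κ * (-1) ^ downs B, fun l hl hch => ?_⟩
  obtain ⟨l₁, m', l₂, rfl, h₁, hm', h₂⟩ := length_split hl
  obtain rfl := List.length_eq_zero_iff.1 hm'
  have hρ : ExteriorAlgebra.ι (Laurent g) ρ * wedge B l₂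
      = (paritySign g l₂ * (-1) ^ downs B) • (wedge B l₂ * ExteriorAlgebra.ι (Laurent g) ρ) := by
    rw [wedge_mul_ι h₂, smul_smul]
    have : paritySign g l₂ * (-1) ^ downs B * (paritySign g l₂ * (-1) ^ downs B) = 1 := by
      have h1 : ((-1) ^ downs B * (-1) ^ downs B : Laurent g) = 1 := by rw [← mul_pow]; simp
      linear_combination ((-1) ^ downs B * (-1) ^ downs B) * paritySign_mul_self (g := g) l₂ + h1
    rw [this, one_smul]
  have hρ' : ∀ X, ExteriorAlgebra.ι (Laurent g) ρ * (wedge B l₂ * X)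
      = (paritySign g l₂ * (-1) ^ downs B) • (wedge B l₂ * (ExteriorAlgebra.ι (Laurent g) ρ * X)) := by
    intro X
    rw [← mul_assoc, hρ, smul_mul_assoc, mul_assoc]
  have hw : wedgeList (g := g) (ρ :: C ++ [δ]) = ExteriorAlgebra.ι (Laurent g) ρ * (wedgeList C
      * ExteriorAlgebra.ι (Laurent g) δ) := by
    simp [wedgeList]
  rw [← smul_mul_assoc, hu l₁ [] l₂ h₁ rfl h₂ hch, hκ, wedge_append_append h₁ rfl, hM, hw]
  simp only [mul_smul_comm, smul_mul_assoc, smul_smul, mul_assoc, hρ', Units.val_mul,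
    Units.val_pow_eq_pow_val, Units.val_neg, Units.val_one, pow_one, wedge_nil, one_mul]
  congr 1
  have hps := paritySign_mul_self (g := g) l₂
  simp only [paritySign_nil, one_mul, downs, List.countP_nil, pow_zero, mul_one]
  linear_combination ((u : Laurent g) * paritySign g l₂ ^ List.countP (fun s => !s.up) A * κ
    * (-1) ^ List.countP (fun s => !s.up) B) * hps

end wedge

end

/-! ### The effect of elementary tangles on strands, vectors and relations -/

section

variable {g : ℕ} {D : DiagramData g} {F : Type*}

theorem qPow_mul (m n : ℤ) : qPow g m * qPow g n = qPow g (m + n) := by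
  simp [qPow, MonoidAlgebra.single_mul_single, ← ofAdd_add]

theorem qPow_zero : qPow g 0 = 1 := rfl

theorem qPow_smul_smul {N : Type*} [AddCommGroup N] [Module (Laurent g) N] (m n : ℤ) (x : N) :
    qPow g m • qPow g n • x = qPow g (m + n) • x := by
  rw [smul_smul, qPow_mul]

/-- A power of `q` as a unit. -/
def qUnit (g : ℕ) (n : ℤ) : (Laurent g)ˣ where
  val := qPow g n
  inv := qPow g (-n)
  val_inv := by rw [qPow_mul, add_neg_cancel, qPow_zero]
  inv_val := by rw [qPow_mul, neg_add_cancel, qPow_zero]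

@[simp] theorem qUnit_val (n : ℤ) : (qUnit g n : Laurent g) = qPow g n := rfl

namespace DiagramData

/-- The vertex of the Gauss diagram of `Zh_Ω(D)` at which a passage takes place. -/
def vertexOf : D.Pass → ZhVertex D
  | .over c => .cross c
  | .under c => .cross c
  | .cut z k => .colorCross z k
  | .mark b => .mark b

end DiagramData

open DiagramData

/-- Upward minus downward strands. -/
def flux (S : List (Strand D F)) : ℤ := (S.map fun s => if s.up then 1 else -1).sum

/-- The indices of the strands are the numbers of upward minus downward strands to their left. -/
def WellIndexed : ℤ → List (Strand D F) → Prop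
  | _, [] => True
  | h, s :: S => s.idx = (if s.up then h else h - 1) ∧ WellIndexed (if s.up then h + 1 else h - 1) S

theorem wellIndexed_append (h : ℤ) (A B : List (Strand D F)) :
    WellIndexed h (A ++ B) ↔ WellIndexed h A ∧ WellIndexed (h + flux A) B := by
  induction A generalizing h with
  | nil => simp [WellIndexed, flux]
  | cons s A ih =>
    rw [List.cons_append, WellIndexed, WellIndexed, ih, and_assoc]
    cases hs : s.up <;> simp [flux, hs, add_assoc, sub_eq_add_neg]

theorem flux_append (A B : List (Strand D F)) : flux (A ++ B) = flux A + flux B := by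
  simp [flux]

/-- Arc, turns and direction. -/
def Strand.label (s : Strand D F) : D.Pass × ℕ × Bool := (s.arc, s.turns, s.up)

/-- The labels of the black points of a section. -/
def blackLabels (a : List (SectionPoint D)) : List (D.Pass × ℕ × Bool) :=
  a.filterMap fun p => p.arc.getLeft?.map fun e => (e, p.turns, p.up)

theorem blackLabels_append (a b : List (SectionPoint D)) :
    blackLabels (a ++ b) = blackLabels a ++ blackLabels b := List.filterMap_append

theorem length_blackLabels (a : List (SectionPoint D)) :
    (blackLabels a).length = blackCount a := by
  induction a with
  | nil => rfl
  | cons p a ih =>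
    obtain ⟨e | e, i, b⟩ := p
    · rw [blackCount, List.countP_cons_of_pos rfl]
      exact congrArg Nat.succ ih
    · rw [blackCount, List.countP_cons_of_neg Bool.false_ne_true]
      exact ih

theorem map_label_nil {M : List (Strand D F)} (h : M.map Strand.label = []) : M = [] :=
  List.map_eq_nil_iff.1 h

theorem map_label_one {M : List (Strand D F)} {e i b} (h : M.map Strand.label = [(e, i, b)]) :
    ∃ n x, M = [⟨e, i, b, n, x⟩] := by
  obtain ⟨s, rfl, hs⟩ := List.map_eq_singleton_iff.1 h
  obtain ⟨e', i', b', n, x⟩ := s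
  simp only [Strand.label, Prod.mk.injEq] at hs
  obtain ⟨rfl, rfl, rfl⟩ := hs
  exact ⟨n, x, rfl⟩

theorem map_label_two {M : List (Strand D F)} {e i b e' i' b'}
    (h : M.map Strand.label = [(e, i, b), (e', i', b')]) :
    ∃ n x n' x', M = [⟨e, i, b, n, x⟩, ⟨e', i', b', n', x'⟩] := by
  obtain ⟨s, M', rfl, hs, hM⟩ := List.map_eq_cons_iff.1 h
  obtain ⟨n', x', rfl⟩ := map_label_one hM
  obtain ⟨a, j, c, n, x⟩ := s
  simp only [Strand.label, Prod.mk.injEq] at hs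
  obtain ⟨rfl, rfl, rfl⟩ := hs
  exact ⟨n, x, n', x', rfl⟩

section local_moves
variable [AddCommGroup F] [Module (Laurent g) F]

/-- The effect of an elementary tangle on the black strands. `δ` is the generator belonging to a
local minimum, `h` is the index of the region on the left, `out` gives the vectors of the arcs
leaving a vertex, normalized by their indices; `gen` is the arc and the index of the generator. The
last two lists are relations. -/
inductive LocalMove (δ : F) (h : ℤ) (out : D.Pass → F) : Option (D.Pass × ℤ) → Piece D →
    List (Strand D F) → List (Strand D F) → List F → List F → Prop
  | cupUp (e : D.Pass) (i : ℕ) : LocalMove δ h out (some (e, h)) (.cup (.inl e) i true) []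
      [⟨e, i + 1, true, h, δ⟩, ⟨e, i, false, h, δ⟩] [] []
  | cupDown (e : D.Pass) (i : ℕ) : LocalMove δ h out (some (e, h - 1)) (.cup (.inl e) i false) []
      [⟨e, i, false, h - 1, δ⟩, ⟨e, i + 1, true, h - 1, δ⟩] [] []
  | capUp (e : D.Pass) (i : ℕ) (x y : F) : LocalMove δ h out none (.cap (.inl e) i true)
      [⟨e, i, true, h, x⟩, ⟨e, i + 1, false, h, y⟩] [] [x - y] [δ]
  | capDown (e : D.Pass) (i : ℕ) (x y : F) : LocalMove δ h out none (.cap (.inl e) i false)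
      [⟨e, i + 1, false, h - 1, y⟩, ⟨e, i, true, h - 1, x⟩] [] [x - y] [δ]
  | virt (e : D.Pass) (i : ℕ) (f : D.Pass) (j : ℕ) (x y : F) :
      LocalMove δ h out none (.virt (.inl e) i (.inl f) j)
        [⟨e, i, true, h, x⟩, ⟨f, j, true, h + 1, y⟩]
        [⟨f, j, true, h, qPow g (-1) • y⟩, ⟨e, i, true, h + 1, qPow g 1 • x⟩] [] [δ]
  | pos (c : Fin D.crossings) (i j : ℕ) (x y : F) (hs : D.sign c = 1)
      (ho : qPow g (h + 1) • out (.over c) = qPow g 1 • x)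
      (hu : qPow g h • out (.under c) = qPow g 1 • y + (1 - qPow g 2) • x) :
      LocalMove δ h out none (.cross c i j)
        [⟨D.next.symm (.over c), i, true, h, x⟩, ⟨D.next.symm (.under c), j, true, h + 1, y⟩]
        [⟨.under c, 0, true, h, qPow g h • out (.under c)⟩,
          ⟨.over c, 0, true, h + 1, qPow g (h + 1) • out (.over c)⟩] [] [δ]
  | neg (c : Fin D.crossings) (i j : ℕ) (x y : F) (hs : D.sign c ≠ 1)
      (ho : qPow g h • out (.over c) = qPow g (-1) • x)
      (hu : qPow g (h + 1) • out (.under c) = qPow g (-1) • y + (1 - qPow g (-2)) • x) :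
      LocalMove δ h out none (.cross c i j)
        [⟨D.next.symm (.under c), j, true, h, y⟩, ⟨D.next.symm (.over c), i, true, h + 1, x⟩]
        [⟨.over c, 0, true, h, qPow g h • out (.over c)⟩,
          ⟨.under c, 0, true, h + 1, qPow g (h + 1) • out (.under c)⟩] [] [δ]
  | cut (z : Palette g) (k : Fin (D.cuts z)) (i j : ℕ) (x : F)
      (ho : qPow g h • out (.cut z k) = colorPow z.dual (-(D.liftSign z k : ℤ)) • x) :
      LocalMove δ h out none (.colorCross z k i j)
        [⟨D.next.symm (.cut z k), j, true, h, x⟩]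
        [⟨.cut z k, 0, true, h, qPow g h • out (.cut z k)⟩] [] [δ]
  | mark (b : Fin D.marks) (i : ℕ) (x : F) (ho : qPow g h • out (.mark b) = x) :
      LocalMove δ h out none (.mark b i)
        [⟨D.next.symm (.mark b), i, true, h, x⟩]
        [⟨.mark b, 0, true, h, qPow g h • out (.mark b)⟩] [] [δ]
  | idle (p : Piece D) (M : List (Strand D F)) (hp : p.value = fun s => tens s 1)
      (hv : ∀ e : D.Pass, p.vertex ≠ some (vertexOf e)) : LocalMove δ h out none p M M [] [δ]

theorem qPow_cancel (n : ℤ) (x : F) : qPow g n • qPow g (-n) • x = x := by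
  rw [qPow_smul_smul, add_neg_cancel, qPow_zero, one_smul]

/-- Powers of `q` are invertible, so the equations for the outgoing vectors can be solved for `out`.
The index convention for downward strands gives both ends of a cup or cap the same index, as one arc
requires. -/
theorem exists_localMove (ord : Equiv.Perm (ColorPoint D)) (p : Piece D) (δ : F) (h : ℤ)
    {M : List (Strand D F)} (hM : M.map Strand.label = blackLabels (p.dom ord))
    (hw : WellIndexed h M) :
    ∃ out gen M' pre post, LocalMove δ h out gen p M M' pre post ∧
      M'.map Strand.label = blackLabels (p.cod) ∧ WellIndexed h M' ∧ flux M' = flux M := by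
  have idle : ∀ p : Piece D, p.value = (fun s => tens s 1) →
      (∀ e : D.Pass, p.vertex ≠ some (vertexOf e)) →
      blackLabels (p.dom ord) = blackLabels p.cod → M.map Strand.label = blackLabels (p.dom ord) →
      ∃ out gen M' pre post, LocalMove δ h out gen p M M' pre post ∧
      M'.map Strand.label = blackLabels (p.cod) ∧ WellIndexed h M' ∧ flux M' = flux M :=
    -- No passage of the link takes place here, so the value of `out` is irrelevant; the relation
    -- `δ` discards the generator of the slice.
    fun p h₁ h₂ h₃ h₄ => ⟨0, none, M, [], [δ], .idle p M h₁ h₂, h₃ ▸ h₄, hw, rfl⟩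
  rcases p with ⟨e | e, i, _ | _⟩ | ⟨e | e, i, _ | _⟩ | ⟨e | e, i, f | f, j⟩ | ⟨c, i, j⟩ |
    ⟨z, k, i, j⟩ | ⟨b, i⟩ | ⟨z, i⟩
  · obtain rfl := map_label_nil hM
    exact ⟨0, _, _, _, _, .cupDown e i, rfl, by simp [WellIndexed], rfl⟩
  · obtain rfl := map_label_nil hM
    exact ⟨0, _, _, _, _, .cupUp e i, rfl, by simp [WellIndexed], rfl⟩
  · exact idle _ rfl (fun e => by simp [Piece.vertex]) rfl hM
  · exact idle _ rfl (fun e => by simp [Piece.vertex]) rfl hM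
  · obtain ⟨n, y, n', x, rfl⟩ := map_label_two (by simpa [Piece.dom, blackLabels] using hM)
    simp only [WellIndexed, Bool.false_eq_true, if_false, if_true, and_true] at hw
    obtain ⟨rfl, rfl⟩ := hw
    exact ⟨0, _, _, _, _, .capDown e i x y, rfl, trivial, rfl⟩
  · obtain ⟨n, x, n', y, rfl⟩ := map_label_two (by simpa [Piece.dom, blackLabels] using hM)
    simp only [WellIndexed, Bool.false_eq_true, if_false, if_true, and_true,
      add_sub_cancel_right] at hw
    obtain ⟨rfl, rfl⟩ := hw
    exact ⟨0, _, _, _, _, .capUp e i x y, rfl, trivial, rfl⟩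
  · exact idle _ rfl (fun e => by simp [Piece.vertex]) rfl hM
  · exact idle _ rfl (fun e => by simp [Piece.vertex]) rfl hM
  · obtain ⟨n, x, n', y, rfl⟩ := map_label_two (by simpa [Piece.dom, blackLabels] using hM)
    simp only [WellIndexed, if_true, and_true] at hw
    obtain ⟨rfl, rfl⟩ := hw
    exact ⟨0, _, _, _, _, .virt e i f j x y, rfl, by simp [WellIndexed], rfl⟩
  · exact idle _ rfl (fun e => by simp [Piece.vertex]) rfl hM
  · exact idle _ rfl (fun e => by simp [Piece.vertex]) rfl hM
  · exact idle _ rfl (fun e => by simp [Piece.vertex]) rfl hM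
  · by_cases hs : D.sign c = 1
    · obtain ⟨n, x, n', y, rfl⟩ := map_label_two (by simpa [Piece.dom, blackLabels, hs] using hM)
      simp only [WellIndexed, if_true, and_true] at hw
      obtain ⟨rfl, rfl⟩ := hw
      exact ⟨fun p => if p = .over c then qPow g (-(n + 1)) • qPow g 1 • x
        else qPow g (-n) • (qPow g 1 • y + (1 - qPow g 2) • x), _, _, _, _,
        .pos c i j x y hs (by simp only [if_true]; rw [qPow_cancel])
          (by rw [if_neg (by simp), qPow_cancel]),
        by simp [Piece.cod, blackLabels, hs, Strand.label], by simp [WellIndexed], rfl⟩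
    · obtain ⟨n, y, n', x, rfl⟩ := map_label_two (by simpa [Piece.dom, blackLabels, hs] using hM)
      simp only [WellIndexed, if_true, and_true] at hw
      obtain ⟨rfl, rfl⟩ := hw
      exact ⟨fun p => if p = .over c then qPow g (-n) • qPow g (-1) • x
        else qPow g (-(n + 1)) • (qPow g (-1) • y + (1 - qPow g (-2)) • x), _, _, _, _,
        .neg c i j x y hs (by simp only [if_true]; rw [qPow_cancel])
          (by rw [if_neg (by simp), qPow_cancel]),
        by simp [Piece.cod, blackLabels, hs, Strand.label], by simp [WellIndexed], rfl⟩
  · obtain ⟨n, x, rfl⟩ := map_label_one (M := M) (e := D.next.symm (.cut z k)) (i := j) (b := true)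
      (by rw [hM]; by_cases hs : D.liftSign z k = 1 <;> simp [Piece.dom, blackLabels, hs] <;> rfl)
    simp only [WellIndexed, if_true, and_true] at hw
    subst hw
    exact ⟨fun _ => qPow g (-n) • colorPow z.dual (-(D.liftSign z k : ℤ)) • x, _, _, _, _,
      .cut z k i j x (by rw [qPow_cancel]),
      by by_cases hs : D.liftSign z k = 1 <;> simp [Piece.cod, blackLabels, hs, Strand.label] <;> rfl,
      by simp [WellIndexed], rfl⟩
  · obtain ⟨n, x, rfl⟩ := map_label_one (M := M) hM
    simp only [WellIndexed, if_true, and_true] at hw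
    subst hw
    exact ⟨fun _ => qPow g (-n) • x, _, _, _, _, .mark b i x (by rw [qPow_cancel]), rfl,
      by simp [WellIndexed], rfl⟩
  · exact idle _ rfl (fun e => by cases e <;> simp [Piece.vertex, vertexOf]) rfl hM

/-- The effect of a slice on the black strands and on the list of relations. -/
def Move (ord : Equiv.Perm (ColorPoint D)) (δ : F) (out : D.Pass → F) (gen : Option (D.Pass × ℤ))
    (s : Slice D) (S T : List (Strand D F) × List F) : Prop :=
  ∃ A M M' B pre post, S.1 = A ++ M ++ B ∧ T.1 = A ++ M' ++ B ∧ T.2 = pre ++ S.2 ++ post ∧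
    A.length = blackCount s.left ∧ M.length = blackCount (s.piece.dom ord) ∧
    LocalMove δ (flux A) out gen s.piece M M' pre post

theorem exists_move (ord : Equiv.Perm (ColorPoint D)) (δ : F) (s : Slice D)
    (S : List (Strand D F) × List F)
    (hS : S.1.map Strand.label = blackLabels (s.left ++ s.piece.dom ord ++ s.right))
    (hw : WellIndexed 0 S.1) :
    ∃ out gen T, Move ord δ out gen s S T ∧
      T.1.map Strand.label = blackLabels (s.left ++ s.piece.cod ++ s.right) ∧
      WellIndexed 0 T.1 := by
  obtain ⟨S, C⟩ := S
  simp only [blackLabels_append] at hS hw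
  obtain ⟨AM, B, rfl, hAM, hB⟩ := List.map_eq_append_iff.1 hS
  obtain ⟨A, M, rfl, hA, hM⟩ := List.map_eq_append_iff.1 hAM
  rw [wellIndexed_append, wellIndexed_append, zero_add] at hw
  obtain ⟨⟨hwA, hwM⟩, hwB⟩ := hw
  obtain ⟨out, gen, M', pre, post, hmove, hM', hw', hf⟩ :=
    exists_localMove ord s.piece δ (flux A) hM hwM
  refine ⟨out, gen, (A ++ M' ++ B, pre ++ C ++ post), ⟨A, M, M', B, pre, post, rfl, rfl, rfl, ?_,
    ?_, hmove⟩, ?_, ?_⟩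
  · rw [← length_blackLabels, ← hA, List.length_map]
  · rw [← length_blackLabels, ← hM, List.length_map]
  · simp only [List.map_append, blackLabels_append, hA, hM', hB]
  · rw [wellIndexed_append, wellIndexed_append, zero_add]
    refine ⟨⟨hwA, hw'⟩, ?_⟩
    rwa [flux_append, hf, ← flux_append]

/-- The moves along a word, started at time `t`. -/
theorem exists_moves (ord : Equiv.Perm (ColorPoint D)) (δ : ℕ → F) {b : List (SectionPoint D)} :
    ∀ (w : List (Slice D)) (a : List (SectionPoint D)), IsTangle ord a w b →
      ∀ (t : ℕ) (S : List (Strand D F) × List F), S.1.map Strand.label = blackLabels a →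
      WellIndexed 0 S.1 →
      ∃ (St : ℕ → List (Strand D F) × List F) (out : ℕ → D.Pass → F)
        (gen : ℕ → Option (D.Pass × ℤ)), St 0 = S ∧
        (∀ j (hj : j < w.length), Move ord (δ (t + j)) (out j) (gen j) w[j] (St j) (St (j + 1))) ∧
        (St w.length).1.map Strand.label = blackLabels b
  | [], a, hw, t, S, hS, _ => by
      obtain rfl : a = b := hw
      exact ⟨fun _ => S, fun _ _ => 0, fun _ => none, rfl, fun j hj => absurd hj (by simp), hS⟩
  | s :: w, a, hw, t, S, hS, hwi => by
      obtain ⟨rfl, hw⟩ := hw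
      obtain ⟨o, gn, T, hmove, hT, hwT⟩ := exists_move ord (δ t) s S hS hwi
      obtain ⟨St, out, gen, h0, hstep, hend⟩ := exists_moves ord δ w _ hw (t + 1) T hT hwT
      refine ⟨fun | 0 => S | j + 1 => St j, fun | 0 => o | j + 1 => out j,
        fun | 0 => gn | j + 1 => gen j, rfl, ?_, hend⟩
      rintro (_ | j) hj
      · simpa [h0] using hmove
      · have := hstep j (by simpa using hj)
        rwa [add_right_comm, add_assoc] at this

end local_moves

end

/-! ### Elementary tangles preserve the determinantal form -/

section

variable {g : ℕ} {D : DiagramData g} {F : Type*} [AddCommGroup F] [Module (Laurent g) F]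

open DiagramData

theorem sum_boolLists_one {N : Type*} [AddCommMonoid N] (f : List Bool → N) :
    ∑ m ∈ boolLists 1, f m = f [false] + f [true] := by
  rw [boolLists_one, Finset.sum_pair (by simp)]

theorem sum_boolLists_two {N : Type*} [AddCommMonoid N] (f : List Bool → N) :
    ∑ m ∈ boolLists 2, f m
      = f [false, false] + (f [false, true] + (f [true, false] + f [true, true])) := by
  rw [boolLists_two, Finset.sum_insert (by simp), Finset.sum_insert (by simp),
    Finset.sum_pair (by simp)]

theorem eq_of_tens_ne_zero {s m : List Bool} {a : Laurent g} (h : tens s a m ≠ 0) : m = s :=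
  (Finsupp.single_apply_ne_zero.1 h).1

theorem tens_apply (s m : List Bool) (a : Laurent g) : tens s a m = if s = m then a else 0 := by
  classical
  rw [tens, Finsupp.single_apply]

theorem eq_or_eq_of_add_ne_zero {s s' m : List Bool} {a a' : Laurent g}
    (h : (tens s a + tens s' a') m ≠ 0) : m = s ∨ m = s' := by
  by_cases h₁ : tens s a m = 0
  · right
    rw [Finsupp.add_apply, h₁, zero_add] at h
    exact eq_of_tens_ne_zero h
  · exact Or.inl (eq_of_tens_ne_zero h₁)

/-- A local map of two upward strands preserves the number of odd factors. -/
structure IsHomogeneous (val : List Bool → TensorSpace g) : Prop where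
  zero : ∀ m, val [false, false] m ≠ 0 → m = [false, false]
  right : ∀ m, val [false, true] m ≠ 0 → m = [false, true] ∨ m = [true, false]
  left : ∀ m, val [true, false] m ≠ 0 → m = [false, true] ∨ m = [true, false]
  both : ∀ m, val [true, true] m ≠ 0 → m = [true, true]

theorem isHomogeneous_virtMatrix : IsHomogeneous (virtMatrix g) :=
  ⟨fun _ h => eq_of_tens_ne_zero h, fun _ h => Or.inr (eq_of_tens_ne_zero h),
    fun _ h => Or.inl (eq_of_tens_ne_zero h), fun _ h => eq_of_tens_ne_zero h⟩

theorem isHomogeneous_rMatrix : IsHomogeneous (rMatrix g) :=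
  ⟨fun _ h => eq_of_tens_ne_zero h, fun _ h => (eq_or_eq_of_add_ne_zero h).symm,
    fun _ h => Or.inl (eq_of_tens_ne_zero h), fun _ h => eq_of_tens_ne_zero h⟩

theorem isHomogeneous_rMatrixInv : IsHomogeneous (rMatrixInv g) :=
  ⟨fun _ h => eq_of_tens_ne_zero h, fun _ h => Or.inr (eq_of_tens_ne_zero h),
    fun _ h => eq_or_eq_of_add_ne_zero h, fun _ h => eq_of_tens_ne_zero h⟩

theorem IsHomogeneous.conserves {val : List Bool → TensorSpace g} (h : IsHomogeneous val)
    {F : Type*} {a b c d : Strand D F} (ha : a.up = true) (hb : b.up = true)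
    (hc : c.up = true) (hd : d.up = true) : Conserves [a, b] [c, d] val := by
  intro m hm m' hne
  obtain ⟨x, y, rfl⟩ := List.length_eq_two.1 hm
  cases x <;> cases y
  · obtain rfl := h.zero _ hne
    simp [charge]
  · obtain rfl | rfl := h.right _ hne <;> simp [charge, hb, hc, hd]
  · obtain rfl | rfl := h.left _ hne <;> simp [charge, ha, hc, hd]
  · obtain rfl := h.both _ hne
    simp [charge, ha, hb, hc, hd]

theorem conserves_diagonal {F : Type*} {a b : Strand D F} (ha : a.up = true)
    (hb : b.up = true) (f : List Bool → Laurent g) :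
    Conserves [a] [b] (fun s => tens s (f s)) := by
  intro m hm m' hne
  obtain ⟨x, rfl⟩ := List.length_eq_one_iff.1 hm
  obtain rfl := eq_of_tens_ne_zero hne
  simp [charge, ha, hb]

/-- A tangle acting as the identity adds a generator and the relation killing it; both enter as a
last factor on the two sides. -/
theorem IsDeterminantal.of_eq {S : List (Strand D F)} {C : List F}
    {vol : ExteriorAlgebra (Laurent g) F} {v : TensorSpace g} (h : IsDeterminantal S C vol v)
    (δ : F) : IsDeterminantal S (C ++ [δ]) (vol * ExteriorAlgebra.ι (Laurent g) δ) v := by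
  obtain ⟨hs, u, hu⟩ := h
  refine ⟨hs, u, fun l hl hch => ?_⟩
  rw [wedgeList_append_singleton, ← mul_assoc, ← smul_mul_assoc, ← smul_mul_assoc, hu l hl hch]

theorem forall_length_two {P : List Bool → Prop} (h₀ : P [false, false]) (h₁ : P [false, true])
    (h₂ : P [true, false]) (h₃ : P [true, true]) (m : List Bool) (hm : m.length = 2) : P m := by
  obtain ⟨x, y, rfl⟩ := List.length_eq_two.1 hm
  cases x <;> cases y <;> assumption

/-- A local map of two upward strands that is the exterior power of a linear map. -/
theorem IsDeterminantal.crossing {A B : List (Strand D F)} {a b c d : Strand D F} {C : List F}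
    {vol : ExteriorAlgebra (Laurent g) F} {v : TensorSpace g} {val : List Bool → TensorSpace g}
    (h : IsDeterminantal (A ++ [a, b] ++ B) C vol v) (hval : IsHomogeneous val)
    (ha : a.up = true) (hb : b.up = true) (hc : c.up = true) (hd : d.up = true)
    (κ : (Laurent g)ˣ) (h₀ : val [false, false] [false, false] = κ)
    (h₁ : val [false, true] [false, true] • b.vec + val [true, false] [false, true] • a.vec
      = (κ : Laurent g) • d.vec)
    (h₂ : val [false, true] [true, false] • b.vec + val [true, false] [true, false] • a.vec
      = (κ : Laurent g) • c.vec)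
    (h₃ : val [true, true] [true, true] • (ExteriorAlgebra.ι (Laurent g) a.vec
      * ExteriorAlgebra.ι (Laurent g) b.vec) = (κ : Laurent g) •
        (ExteriorAlgebra.ι (Laurent g) c.vec * ExteriorAlgebra.ι (Laurent g) d.vec)) (δ : F) :
    IsDeterminantal (A ++ [c, d] ++ B) (C ++ [δ]) (vol * ExteriorAlgebra.ι (Laurent g) δ)
      (insertMap A.length 2 val v) := by
  refine h.vertex (hval.conserves ha hb hc hd) (by simp [downs, ha, hb]) (by simp [downs, hc, hd])
    κ (fun m' hm' => ?_) δ
  refine (sum_boolLists_two _).trans ?_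
  have e₀ : ∀ m, m ≠ [false, false] → val [false, false] m = 0 := fun m hm =>
    not_not.1 (mt (hval.zero m) hm)
  have e₁ : ∀ m, ¬(m = [false, true] ∨ m = [true, false]) → val [false, true] m = 0 := fun m hm =>
    not_not.1 (mt (hval.right m) hm)
  have e₂ : ∀ m, ¬(m = [false, true] ∨ m = [true, false]) → val [true, false] m = 0 := fun m hm =>
    not_not.1 (mt (hval.left m) hm)
  have e₃ : ∀ m, m ≠ [true, true] → val [true, true] m = 0 := fun m hm =>
    not_not.1 (mt (hval.both m) hm)
  obtain ⟨x, y, rfl⟩ := List.length_eq_two.1 hm'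
  cases x <;> cases y
  · simp [e₁, e₂, e₃, h₀, wedge, Strand.factor, ha, hb, hc, hd]
  · simp [e₀, e₃, wedge, Strand.factor, ha, hb, hc, hd]
    rw [← map_smul, ← map_smul, ← map_smul, ← map_add, h₁]
  · simp [e₀, e₃, wedge, Strand.factor, ha, hb, hc, hd]
    rw [← map_smul, ← map_smul, ← map_smul, ← map_add, h₂]
  · simp [e₀, e₁, e₂, h₃, wedge, Strand.factor, ha, hb, hc, hd]

theorem qPow_one_mul_neg : qPow g 1 * qPow g (-1) = 1 := by rw [qPow_mul]; rfl

theorem qPow_neg_mul_one : qPow g (-1) * qPow g 1 = 1 := by rw [qPow_mul]; rfl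

/-- The place where the values of the functor are used. Each case supplies the scalar `κ` by which
its value differs from the normalized exterior operation: `-1` and `-q⁻¹` for cups, `q` and `1` for
caps, `q⁻¹` and `q` for positive and negative crossings, and `1` for virtual crossings, coloured
crossings and marks. -/
theorem IsDeterminantal.move {ord : Equiv.Perm (ColorPoint D)} {δ : F} {out : D.Pass → F}
    {gen : Option (D.Pass × ℤ)} {s : Slice D} {S T : List (Strand D F) × List F}
    {vol : ExteriorAlgebra (Laurent g) F} {v : TensorSpace g} (h : IsDeterminantal S.1 S.2 vol v)
    (hm : Move ord δ out gen s S T) :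
    IsDeterminantal T.1 T.2 (vol * ExteriorAlgebra.ι (Laurent g) δ) (s.value ord v) := by
  obtain ⟨A, M, M', B, pre, post, hS, hT, hC, hA, hM, hmove⟩ := hm
  have hval : s.value ord v = insertMap A.length M.length s.piece.value v := by
    rw [hA, hM]; rfl
  rw [hval, hT, hC]
  rw [hS] at h
  clear hval hT hC hS hM hA
  generalize s.piece = p at hmove
  have hq2 : qPow g 2 = qPow g 1 * qPow g 1 := by rw [qPow_mul]; rfl
  have hq2' : qPow g (-2) = qPow g (-1) * qPow g (-1) := by rw [qPow_mul]; rfl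
  have hqq := qPow_one_mul_neg (g := g)
  have hqq' := qPow_neg_mul_one (g := g)
  generalize flux A = n at hmove
  cases hmove with
  | cupUp e i =>
    rw [List.append_nil, List.nil_append]
    refine h.minimum ?_ (by simp [downs]) (-1) δ (fun m' hm' => ?_) (fun m' hm' => ?_)
    · intro m hm m' hne
      obtain rfl | rfl := eq_or_eq_of_add_ne_zero hne <;>
        cases List.length_eq_zero_iff.1 hm <;> simp [charge]
    all_goals
      revert m'
      apply forall_length_two <;>
        simp [charge, wedge, Strand.factor, Piece.value, tens_apply]
    -- Left over is the one index of negative charge on the two new strands, where neither vector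
    -- occurs.
    exact ⟨-1, by simp⟩
  | cupDown e i =>
    rw [List.append_nil, List.nil_append]
    refine h.minimum ?_ (by simp [downs]) (-(qUnit g (-1))) δ (fun m' hm' => ?_)
      (fun m' hm' => ?_)
    · intro m hm m' hne
      have hne' : (tens [false, false] (qPow g (-1)) + tens [true, true] (-(qPow g (-1)))) m' ≠ 0 := by
        rw [tens, tens, Finsupp.single_neg, ← sub_eq_add_neg]; exact hne
      obtain rfl | rfl := eq_or_eq_of_add_ne_zero hne' <;>
        cases List.length_eq_zero_iff.1 hm <;> simp [charge]
    all_goals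
      revert m'
      apply forall_length_two <;>
        simp [charge, wedge, Strand.factor, Piece.value, tens_apply]
    exact ⟨-1, by simp⟩
  | capUp e i x y =>
    refine h.maximum ?_ (by simp [downs]) (qUnit g 1) δ _ ?_
    · intro m hm m' hne
      obtain ⟨a, b, rfl⟩ := List.length_eq_two.1 hm
      cases a <;> cases b <;> simp [Piece.value] at hne <;>
        simp [eq_of_tens_ne_zero hne, charge]
    · rw [List.length_cons, List.length_singleton, sum_boolLists_two]
      simp [wedge, Strand.factor, Piece.value, tens_apply, sub_eq_add_neg, add_comm]
  | capDown e i x y =>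
    refine h.maximum ?_ (by simp [downs]) 1 δ _ ?_
    · intro m hm m' hne
      obtain ⟨a, b, rfl⟩ := List.length_eq_two.1 hm
      cases a <;> cases b <;> simp [Piece.value] at hne <;>
        simp [eq_of_tens_ne_zero hne, charge]
    · rw [List.length_cons, List.length_singleton, sum_boolLists_two]
      simp [wedge, Strand.factor, Piece.value, tens_apply, sub_eq_add_neg, add_comm]
  | virt e i f j x y =>
    refine h.crossing isHomogeneous_virtMatrix rfl rfl rfl rfl 1 ?_ ?_ ?_ ?_ δ
    · simp [virtMatrix, tens_apply]
    · simp [virtMatrix, tens_apply]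
    · simp [virtMatrix, tens_apply]
    · simp [virtMatrix, tens_apply]
      rw [ι_mul_ι, smul_smul, hqq, one_smul, neg_neg]
  | pos c i j x y hs ho hu =>
    have hv : (Piece.cross c i j).value = rMatrixInv g := by simp [Piece.value, hs]
    rw [hv, hu, ho]
    refine h.crossing isHomogeneous_rMatrixInv rfl rfl rfl rfl (qUnit g (-1)) ?_ ?_ ?_ ?_ δ
    · simp [rMatrixInv, tens_apply]
    · simp [rMatrixInv, tens_apply, smul_smul, hqq']
    · simp only [rMatrixInv, tens_apply, Finsupp.add_apply, qUnit_val, hq2, smul_add, smul_smul, hqq']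
      simp only [if_true, one_smul]
      simp only [reduceCtorEq, List.cons.injEq, false_and, and_false, if_false, zero_add]
      congr 2
      linear_combination (qPow g 1) * hqq
    -- Two odd indices: the summand of the under-strand proportional to `x` is killed by the factor
    -- `x` of the over-strand, leaving a multiple of the product of `x` and `y`.
    · simp only [rMatrixInv, tens_apply, if_true, map_add, map_smul, add_mul, smul_mul_assoc,
        mul_smul_comm, ExteriorAlgebra.ι_sq_zero, smul_zero, add_zero, qUnit_val]
      rw [ι_mul_ι y x, smul_neg, smul_neg, smul_neg, smul_smul, smul_smul, neg_smul]
      congr 2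
      linear_combination (-qPow g 1) * hqq
  | neg c i j x y hs ho hu =>
    have hv : (Piece.cross c i j).value = rMatrix g := by simp [Piece.value, hs]
    rw [hv, hu, ho]
    refine h.crossing isHomogeneous_rMatrix rfl rfl rfl rfl (qUnit g 1) ?_ ?_ ?_ ?_ δ
    · simp [rMatrix, tens_apply]
    · simp only [rMatrix, tens_apply, Finsupp.add_apply, qUnit_val, hq2', smul_add, smul_smul, hqq]
      simp only [if_true, one_smul]
      simp only [reduceCtorEq, List.cons.injEq, false_and, and_false, if_false, zero_add]
      rw [add_comm]
      congr 2
      linear_combination (qPow g (-1)) * hqq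
    · simp [rMatrix, tens_apply, smul_smul, hqq]
    · simp only [rMatrix, tens_apply, if_true, map_add, map_smul, mul_add, smul_mul_assoc,
        mul_smul_comm, ExteriorAlgebra.ι_sq_zero, smul_zero, add_zero, qUnit_val]
      rw [ι_mul_ι x y, smul_neg, smul_neg, smul_neg, smul_smul, smul_smul, neg_smul]
      congr 2
      linear_combination (-qPow g (-1)) * hqq
  | cut z k i j x ho =>
    rw [ho, List.nil_append]
    refine h.vertex (M' := [⟨.cut z k, 0, true, n, _⟩]) (conserves_diagonal rfl rfl fun s =>
      if s = [true] then colorPow z.dual (-(D.liftSign z k : ℤ)) else 1) rfl rfl 1 ?_ δ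
    intro m hm
    obtain ⟨a, rfl⟩ := List.length_eq_one_iff.1 hm
    refine (sum_boolLists_one _).trans ?_
    cases a <;> simp [wedge, Strand.factor, tens_apply]
  | mark b i x ho =>
    rw [ho, List.nil_append]
    refine h.vertex (M' := [⟨.mark b, 0, true, n, x⟩]) (conserves_diagonal rfl rfl fun _ => 1) rfl rfl 1 ?_ δ
    intro m hm
    obtain ⟨a, rfl⟩ := List.length_eq_one_iff.1 hm
    refine (sum_boolLists_one _).trans ?_
    cases a <;> simp [wedge, Strand.factor, tens_apply]
  | idle p M hp hv =>
    rw [hp, insertMap_id]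
    exact h.of_eq δ

end

/-! ### Vectors of strands and the substituted Fox relations -/

section

variable {g : ℕ} {D : DiagramData g}

open DiagramData

theorem substitution_mono (n : ℤ) (f : Palette g →₀ ℤ) :
    substitution g (mono (Multiplicative.ofAdd (n, f)))
      = mono (Multiplicative.ofAdd (-2 * n, -f)) := by
  simp [substitution, mono]

theorem gradT_zpow (n : ℤ) : gradT g ^ n = Multiplicative.ofAdd (n, 0) := by
  rw [gradT, ← ofAdd_zsmul]; simp

theorem gradLoop_zpow (z : Palette g) (n : ℤ) :
    gradLoop z ^ n = Multiplicative.ofAdd (0, Finsupp.single z n) := by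
  rw [gradLoop, ← ofAdd_zsmul]; simp

theorem substitution_gradT_zpow (n : ℤ) :
    substitution g (mono (gradT g ^ (-n))) = qPow g (2 * n) := by
  rw [gradT_zpow, substitution_mono]
  simp [mono, qPow]

theorem substitution_gradLoop_zpow (z : Palette g) (n : ℤ) :
    substitution g (mono (gradLoop z ^ n)) = colorPow z (-n) := by
  rw [gradLoop_zpow, substitution_mono]
  simp [mono, colorPow]

/-- The element of an outgoing arc in terms of those of the incoming arcs. -/
def outValue {N : Type*} [AddCommGroup N] [Module (Laurent g) N] (b : D.Pass → N) : D.Pass → N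
  | .over c => b (D.next.symm (.over c))
  | .mark c => b (D.next.symm (.mark c))
  | .under c => qPow g (2 * (D.sign c : ℤ)) • b (D.next.symm (.under c))
      + (1 - qPow g (2 * (D.sign c : ℤ))) • b (D.next.symm (.over c))
  | .cut z k => colorPow z.dual (-(D.liftSign z k : ℤ)) • b (D.next.symm (.cut z k))

section modules

variable {N F : Type*} [AddCommGroup N] [Module (Laurent g) N] [AddCommGroup F]
  [Module (Laurent g) F]

/-- The Fox row of an under-passage mentions the over-arc leaving the crossing, the local value the
one arriving; the row of the over-passage identifies the two. -/
theorem foxRelation_iff (b : D.Pass → N) :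
    (∀ p, D.FoxRelation (substitution g) b p) ↔ ∀ p, b p = outValue b p := by
  constructor
  · intro h p
    have hp := h p
    rcases p with c | c | ⟨z, k⟩ | c <;>
      simp only [FoxRelation, substitution_gradT_zpow, substitution_gradLoop_zpow] at hp
    · exact hp
    · have ho := h (.over c)
      simp only [FoxRelation] at ho
      rw [hp, ho]
      rfl
    · exact hp
    · exact hp
  · intro h p
    have hp := h p
    rcases p with c | c | ⟨z, k⟩ | c <;>
      simp only [FoxRelation, substitution_gradT_zpow, substitution_gradLoop_zpow]
    · exact hp
    · rw [hp, h (.over c)]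
      rfl
    · exact hp
    · exact hp

/-- The vector of the strand is the element of its arc, up to the power of `q` given by the index. -/
def Strand.Matches (π : F →ₗ[Laurent g] N) (b : D.Pass → N) (s : Strand D F) : Prop :=
  π s.vec = qPow g s.idx • b s.arc

theorem qPow_smul_injective (n : ℤ) {x y : N} (h : qPow g n • x = qPow g n • y) : x = y := by
  have := congrArg (fun x => qPow g (-n) • x) h
  simpa [qPow_smul_smul, qPow_zero] using this

variable {δ : F} {h : ℤ} {out : D.Pass → F} {gen : Option (D.Pass × ℤ)} {p : Piece D}
  {M M' : List (Strand D F)} {pre post : List F} {π : F →ₗ[Laurent g] N} {b : D.Pass → N}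

/-- The powers of `q` in the crossing rules compensate the change of index of strands that change
sides. What remains at a crossing of sign `s` is the Wirtinger rule with coefficient `q ^ (2 s)`. -/
theorem LocalMove.map_out (hm : LocalMove δ h out gen p M M' pre post)
    (hM : ∀ s ∈ M, s.Matches π b) (e : D.Pass) (he : p.vertex = some (vertexOf e)) :
    π (out e) = outValue b e := by
  cases hm with
  | cupUp => simp [Piece.vertex] at he
  | cupDown => simp [Piece.vertex] at he
  | capUp => simp [Piece.vertex] at he
  | capDown => simp [Piece.vertex] at he
  | virt => simp [Piece.vertex] at he
  | idle _ _ _ hv => exact absurd he (hv e)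
  | pos c i j x y hs ho hu =>
    simp only [List.mem_cons, List.not_mem_nil, or_false, forall_eq_or_imp, forall_eq,
      Strand.Matches] at hM
    obtain ⟨hx, hy⟩ := hM
    rcases e with c' | c' | ⟨z, k⟩ | c' <;>
      simp only [Piece.vertex, vertexOf, Option.some.injEq, ZhVertex.cross.injEq,
        reduceCtorEq] at he
    · subst he
      apply qPow_smul_injective (g := g) (h + 1)
      rw [← map_smul, ho, map_smul, hx, qPow_smul_smul, add_comm]
      rfl
    · subst he
      apply qPow_smul_injective (g := g) h
      rw [← map_smul, hu, map_add, map_smul, map_smul, hx, hy, qPow_smul_smul, outValue, hs,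
        smul_add, smul_comm (qPow g h) (1 - _), Units.val_one, mul_one, qPow_smul_smul]
      congr 3
      ring
  | neg c i j x y hs ho hu =>
    simp only [List.mem_cons, List.not_mem_nil, or_false, forall_eq_or_imp, forall_eq,
      Strand.Matches] at hM
    obtain ⟨hy, hx⟩ := hM
    rcases e with c' | c' | ⟨z, k⟩ | c' <;>
      simp only [Piece.vertex, vertexOf, Option.some.injEq, ZhVertex.cross.injEq,
        reduceCtorEq] at he
    · subst he
      apply qPow_smul_injective (g := g) h
      rw [← map_smul, ho, map_smul, hx, qPow_smul_smul, neg_add_cancel_comm_assoc]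
      rfl
    · subst he
      have hs' : D.sign c = -1 := (Int.units_eq_one_or _).resolve_left hs
      apply qPow_smul_injective (g := g) (h + 1)
      rw [← map_smul, hu, map_add, map_smul, map_smul, hx, hy, qPow_smul_smul, outValue, hs',
        smul_add, smul_comm (qPow g (h + 1)) (1 - _), Units.val_neg, Units.val_one, mul_neg,
        mul_one, qPow_smul_smul]
      congr 3
      ring
  | cut z k i j x ho =>
    simp only [List.mem_singleton, forall_eq, Strand.Matches] at hM
    rcases e with c' | c' | ⟨z', k'⟩ | c' <;>
      simp only [Piece.vertex, vertexOf, Option.some.injEq, reduceCtorEq] at he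
    cases he
    apply qPow_smul_injective (g := g) h
    rw [← map_smul, ho, map_smul, hM, outValue, smul_comm]
  | mark c i x ho =>
    simp only [List.mem_singleton, forall_eq, Strand.Matches] at hM
    rcases e with c' | c' | ⟨z', k'⟩ | c' <;>
      simp only [Piece.vertex, vertexOf, Option.some.injEq, reduceCtorEq] at he
    cases he
    apply qPow_smul_injective (g := g) h
    rw [← map_smul, ho, hM, outValue]

/-- The element of the generator of a slice. -/
def genValue (b : D.Pass → N) : Option (D.Pass × ℤ) → N
  | some (e, n) => qPow g n • b e
  | none => 0

theorem LocalMove.matches_forward (hm : LocalMove δ h out gen p M M' pre post)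
    (hδ : π δ = genValue b gen) (hM : ∀ s ∈ M, s.Matches π b)
    (hout : ∀ e, p.vertex = some (vertexOf e) → π (out e) = b e) :
    (∀ s ∈ M', s.Matches π b) ∧ (∀ r ∈ pre, π r = 0) ∧ ∀ r ∈ post, π r = 0 := by
  cases hm with
  | cupUp | cupDown => simpa [Strand.Matches, genValue] using hδ
  | capUp | capDown =>
    simp only [List.mem_cons, List.not_mem_nil, or_false, forall_eq_or_imp, forall_eq,
      Strand.Matches] at hM
    exact ⟨by simp, by simp [hM.1, hM.2], by simpa [genValue] using hδ⟩
  | virt e i f j x y =>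
    simp only [List.mem_cons, List.not_mem_nil, or_false, forall_eq_or_imp, forall_eq,
      Strand.Matches] at hM
    refine ⟨?_, by simp, by simpa [genValue] using hδ⟩
    simp only [List.mem_cons, List.not_mem_nil, or_false, forall_eq_or_imp, forall_eq,
      Strand.Matches, map_smul, hM, qPow_smul_smul, add_comm h,
      neg_add_cancel_left, and_self]
  | pos c i j x y hs ho hu =>
    refine ⟨?_, by simp, by simpa [genValue] using hδ⟩
    simp [Strand.Matches, hout (.over c) rfl, hout (.under c) rfl]
  | neg c i j x y hs ho hu =>
    refine ⟨?_, by simp, by simpa [genValue] using hδ⟩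
    simp [Strand.Matches, hout (.over c) rfl, hout (.under c) rfl]
  | cut z k i j x ho =>
    refine ⟨?_, by simp, by simpa [genValue] using hδ⟩
    simp [Strand.Matches, hout (.cut z k) rfl]
  | mark c i x ho =>
    refine ⟨?_, by simp, by simpa [genValue] using hδ⟩
    simp [Strand.Matches, hout (.mark c) rfl]
  | idle => exact ⟨hM, by simp, by simpa [genValue] using hδ⟩

/-- An upward strand is traced to what lies below it: a vertex, where `out` is prescribed, or a cup,
whose other end carries the same vector and has one turn fewer. -/
theorem LocalMove.matches_up (hm : LocalMove δ h out gen p M M' pre post) (i : ℕ)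
    (hM : ∀ s ∈ M, s.turns = i → s.up = true → s.Matches π b)
    (hi : ∀ s ∈ M', s.turns + 1 = i → s.Matches π b)
    (hout : ∀ e, p.vertex = some (vertexOf e) → π (out e) = b e) :
    ∀ s ∈ M', s.turns = i → s.up = true → s.Matches π b := by
  cases hm with
  | cupUp | cupDown =>
    simp only [List.mem_cons, List.not_mem_nil, or_false, forall_eq_or_imp, forall_eq,
      Strand.Matches, false_imp_iff, imp_true_iff, true_and, and_true, true_imp_iff,
      Bool.false_eq_true] at hi ⊢
    tauto
  | capUp | capDown => simp
  | virt e j f k x y =>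
    simp only [List.mem_cons, List.not_mem_nil, or_false, forall_eq_or_imp, forall_eq,
      Strand.Matches, true_imp_iff, map_smul] at hM ⊢
    refine ⟨fun hk => ?_, fun hj => ?_⟩
    · rw [hM.2 hk, qPow_smul_smul, neg_add_cancel_comm_assoc]
    · rw [hM.1 hj, qPow_smul_smul, add_comm]
  | pos c i j x y hs ho hu =>
    simp [Strand.Matches, hout (.over c) rfl, hout (.under c) rfl]
  | neg c i j x y hs ho hu =>
    simp [Strand.Matches, hout (.over c) rfl, hout (.under c) rfl]
  | cut z k i j x ho => simp [Strand.Matches, hout (.cut z k) rfl]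
  | mark c i x ho => simp [Strand.Matches, hout (.mark c) rfl]
  | idle => exact hM

/-- A downward strand is traced to the cap above it, whose relation equates its vector with that of
an upward strand with one turn fewer. -/
theorem LocalMove.matches_down (hm : LocalMove δ h out gen p M M' pre post) (i : ℕ)
    (hM' : ∀ s ∈ M', s.turns = i → s.up = false → s.Matches π b)
    (hi : ∀ s ∈ M, s.turns + 1 = i → s.Matches π b)
    (hpre : ∀ r ∈ pre, π r = 0) :
    ∀ s ∈ M, s.turns = i → s.up = false → s.Matches π b := by
  cases hm with
  | capUp | capDown =>
    simp only [List.mem_singleton, forall_eq, map_sub, sub_eq_zero] at hpre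
    simp only [List.mem_cons, List.not_mem_nil, or_false, forall_eq_or_imp, forall_eq,
      Strand.Matches, false_imp_iff, imp_true_iff, true_and, and_true, true_imp_iff,
      Bool.true_eq_false, hpre] at hi ⊢
    tauto
  | idle => exact hM'
  | _ => simp

theorem LocalMove.gen_eq (hm : LocalMove δ h out gen p M M' pre post)
    (hpre : ∀ r ∈ post, π r = 0) (hM' : ∀ s ∈ M', s.Matches π b) : π δ = genValue b gen := by
  cases hm with
  | cupUp | cupDown => simpa [Strand.Matches, genValue] using hM'
  | _ => simpa [genValue] using hpre

/-- Each slice brings one generator. It is balanced by a relation at once, or, at a cup, by a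
downward strand whose cap will supply the missing relation. -/
theorem LocalMove.length_add_downs (hm : LocalMove δ h out gen p M M' pre post) :
    pre.length + post.length + downs M' = downs M + 1 := by
  cases hm <;> simp [downs]
  omega

end modules

end

/-! ### Runs of a closed word -/

section

variable {g : ℕ} {D : DiagramData g}

open DiagramData

section run

variable {F N : Type*} [AddCommGroup F] [Module (Laurent g) F] [AddCommGroup N]
  [Module (Laurent g) N] {ord : Equiv.Perm (ColorPoint D)} {w : List (Slice D)} {δ : ℕ → F}
  {St : ℕ → List (Strand D F) × List F} {out : ℕ → D.Pass → F} {gen : ℕ → Option (D.Pass × ℤ)}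
  {π : F →ₗ[Laurent g] N} {b : D.Pass → N}

/-- The sections and relations `St` belong to the closed word `w`. -/
structure IsRun (ord : Equiv.Perm (ColorPoint D)) (w : List (Slice D)) (δ : ℕ → F)
    (St : ℕ → List (Strand D F) × List F) (out : ℕ → D.Pass → F)
    (gen : ℕ → Option (D.Pass × ℤ)) : Prop where
  start : St 0 = ([], [])
  move : ∀ j (hj : j < w.length), Move ord (δ j) (out j) (gen j) w[j] (St j) (St (j + 1))
  endpoint : (St w.length).1 = []

theorem exists_isRun (hw : IsTangle ord [] w []) (δ : ℕ → F) :
    ∃ St out gen, IsRun ord w δ St out gen := by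
  obtain ⟨St, out, gen, h0, h1, h2⟩ := exists_moves ord δ w [] hw 0 ([], []) rfl trivial
  refine ⟨St, out, gen, h0, fun j hj => ?_, map_label_nil h2⟩
  simpa using h1 j hj

namespace IsRun

theorem length_add_downs (h : IsRun ord w δ St out gen) (j : ℕ) (hj : j ≤ w.length) :
    (St j).2.length + downs (St j).1 = j := by
  induction j with
  | zero => simp [h.start, downs]
  | succ j ih =>
    obtain ⟨A, M, M', B, pre, post, e₁, e₂, e₃, -, -, hm⟩ := h.move j hj
    have := ih (by omega)
    have hl := hm.length_add_downs
    rw [e₁] at this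
    rw [e₂, e₃]
    simp only [downs, List.length_append, List.countP_append] at this hl ⊢
    omega

theorem length_relations (h : IsRun ord w δ St out gen) : (St w.length).2.length = w.length := by
  simpa [h.endpoint, downs] using h.length_add_downs w.length le_rfl

theorem mem_relations (h : IsRun ord w δ St out gen) {j k : ℕ} (hjk : j ≤ k) (hk : k ≤ w.length)
    {r : F} (hr : r ∈ (St j).2) : r ∈ (St k).2 := by
  induction k, hjk using Nat.le_induction with
  | base => exact hr
  | succ k hjk ih =>
    obtain ⟨A, M, M', B, pre, post, e₁, e₂, e₃, -, -, hm⟩ := h.move k hk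
    rw [e₃]
    simp [ih (by omega)]

theorem isDeterminantal (h : IsRun ord w δ St out gen) (j : ℕ) (hj : j ≤ w.length) :
    IsDeterminantal (St j).1 (St j).2 (wedgeList ((List.range j).map δ))
      ((w.take j).foldl (fun v s => s.value ord v) (tens [] 1)) := by
  induction j with
  | zero =>
    simp only [h.start, List.take_zero, List.foldl_nil, List.range_zero, List.map_nil]
    refine ⟨fun l hl => ?_, 1, fun l hl _ => ?_⟩
    · rw [eq_of_tens_ne_zero hl]
      exact ⟨rfl, rfl⟩
    · obtain rfl := List.length_eq_zero_iff.1 hl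
      simp [tens, wedge, wedgeList]
  | succ j ih =>
    rw [List.range_succ, List.map_append, List.map_singleton, wedgeList_append_singleton,
      List.take_succ_eq_append_getElem hj, List.foldl_append]
    exact (ih (by omega)).move (h.move j hj)

theorem matches_forward (h : IsRun ord w δ St out gen)
    (hb : ∀ p, b p = outValue b p)
    (hδ : ∀ j < w.length, π (δ j) = genValue b (gen j)) (j : ℕ) (hj : j ≤ w.length) :
    (∀ s ∈ (St j).1, s.Matches π b) ∧ ∀ r ∈ (St j).2, π r = 0 := by
  induction j with
  | zero => simp [h.start]
  | succ j ih =>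
    obtain ⟨A, M, M', B, pre, post, e₁, e₂, e₃, -, -, hm⟩ := h.move j hj
    obtain ⟨h₁, h₂⟩ := ih (by omega)
    rw [e₁] at h₁
    simp only [List.mem_append] at h₁
    have hM : ∀ s ∈ M, s.Matches π b := fun s hs => h₁ s (Or.inl (Or.inr hs))
    obtain ⟨h₃, h₄, h₅⟩ := hm.matches_forward (hδ j hj) hM
      fun e he => (hm.map_out hM e he).trans (hb e).symm
    rw [e₂, e₃]
    simp only [List.mem_append]
    refine ⟨?_, ?_⟩
    · rintro s ((hs | hs) | hs)
      · exact h₁ s (Or.inl (Or.inl hs))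
      · exact h₃ s hs
      · exact h₁ s (Or.inr hs)
    · rintro r ((hr | hr) | hr)
      · exact h₄ r hr
      · exact h₂ r hr
      · exact h₅ r hr

theorem map_out (h : IsRun ord w δ St out gen) (j : ℕ) (hj : j < w.length)
    (hM : ∀ s ∈ (St j).1, s.Matches π b) (e : D.Pass)
    (he : w[j].piece.vertex = some (vertexOf e)) : π (out j e) = outValue b e := by
  obtain ⟨A, M, M', B, pre, post, e₁, e₂, e₃, -, -, hm⟩ := h.move j hj
  refine hm.map_out (fun s hs => hM s ?_) e he
  rw [e₁]
  simp [hs]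

theorem matches_up (h : IsRun ord w δ St out gen)
    (hout : ∀ j (hj : j < w.length) e, w[j].piece.vertex = some (vertexOf e) → π (out j e) = b e)
    (i : ℕ) (hi : ∀ j ≤ w.length, ∀ s ∈ (St j).1, s.turns + 1 = i → s.Matches π b)
    (j : ℕ) (hj : j ≤ w.length) :
    ∀ s ∈ (St j).1, s.turns = i → s.up = true → s.Matches π b := by
  induction j with
  | zero => simp [h.start]
  | succ j ih =>
    obtain ⟨A, M, M', B, pre, post, e₁, e₂, e₃, -, -, hm⟩ := h.move j hj
    have h₁ := ih (by omega)
    have h₂ := hi (j + 1) hj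
    rw [e₁] at h₁
    rw [e₂] at h₂ ⊢
    simp only [List.mem_append] at h₁ h₂ ⊢
    have := hm.matches_up i (fun s hs => h₁ s (Or.inl (Or.inr hs)))
      (fun s hs => h₂ s (Or.inl (Or.inr hs))) (hout j hj)
    rintro s ((hs | hs) | hs)
    · exact h₁ s (Or.inl (Or.inl hs))
    · exact this s hs
    · exact h₁ s (Or.inr hs)

theorem matches_down (h : IsRun ord w δ St out gen) (hrel : ∀ r ∈ (St w.length).2, π r = 0)
    (i : ℕ) (hi : ∀ j ≤ w.length, ∀ s ∈ (St j).1, s.turns + 1 = i → s.Matches π b)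
    (j : ℕ) (hj : j ≤ w.length) :
    ∀ s ∈ (St j).1, s.turns = i → s.up = false → s.Matches π b := by
  induction hj using Nat.decreasingInduction with
  | self => simp [h.endpoint]
  | of_succ j hj ih =>
    obtain ⟨A, M, M', B, pre, post, e₁, e₂, e₃, -, -, hm⟩ := h.move j hj
    have h₂ := hi j hj.le
    rw [e₂] at ih
    rw [e₁] at h₂ ⊢
    simp only [List.mem_append] at ih h₂ ⊢
    have := hm.matches_down i (fun s hs => ih s (Or.inl (Or.inr hs)))
      (fun s hs => h₂ s (Or.inl (Or.inr hs)))
      (fun r hr => hrel r (h.mem_relations hj le_rfl (by rw [e₃]; simp [hr])))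
    rintro s ((hs | hs) | hs)
    · exact ih s (Or.inl (Or.inl hs))
    · exact this s hs
    · exact ih s (Or.inr hs)

/-- Once the relations hold, each arc carries a single element up to powers of `q`. The induction is
on the number of turns since the vertex that the arc leaves: upward strands are followed upwards
through the word, downward strands back from its end. -/
theorem matches_of_relations (h : IsRun ord w δ St out gen)
    (hrel : ∀ r ∈ (St w.length).2, π r = 0)
    (hout : ∀ j (hj : j < w.length) e, w[j].piece.vertex = some (vertexOf e) → π (out j e) = b e)
    (j : ℕ) (hj : j ≤ w.length) : ∀ s ∈ (St j).1, s.Matches π b := by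
  have key : ∀ i, ∀ j ≤ w.length, ∀ s ∈ (St j).1, s.turns = i → s.Matches π b := by
    intro i
    induction i with
    | zero =>
      intro j hj s hs hi
      cases hup : s.up
      · exact h.matches_down hrel 0 (fun _ _ _ _ h => absurd h (by simp)) j hj s hs hi hup
      · exact h.matches_up hout 0 (fun _ _ _ _ h => absurd h (by simp)) j hj s hs hi hup
    | succ i ih =>
      intro j hj s hs hi
      have ih' : ∀ j ≤ w.length, ∀ s ∈ (St j).1, s.turns + 1 = i + 1 → s.Matches π b :=
        fun j hj s hs h => ih j hj s hs (by omega)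
      cases hup : s.up
      · exact h.matches_down hrel _ ih' j hj s hs hi hup
      · exact h.matches_up hout _ ih' j hj s hs hi hup
  exact fun s hs => key _ j hj s hs rfl

theorem gen_eq (h : IsRun ord w δ St out gen) (hrel : ∀ r ∈ (St w.length).2, π r = 0)
    (hm : ∀ j ≤ w.length, ∀ s ∈ (St j).1, s.Matches π b) (j : ℕ) (hj : j < w.length) :
    π (δ j) = genValue b (gen j) := by
  obtain ⟨A, M, M', B, pre, post, e₁, e₂, e₃, -, -, hmove⟩ := h.move j hj
  refine hmove.gen_eq (fun r hr => hrel r (h.mem_relations hj le_rfl (by rw [e₃]; simp [hr])))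
    (fun s hs => hm (j + 1) hj s (by rw [e₂]; simp [hs]))

end IsRun

end run

theorem unique_vertex {w : List (Slice D)}
    (hw : (w.filterMap fun s => s.piece.vertex).Nodup) {v : ZhVertex D} {i j : ℕ}
    {hi : i < w.length} {hj : j < w.length} (h₁ : w[i].piece.vertex = some v)
    (h₂ : w[j].piece.vertex = some v) : i = j := by
  rw [List.Nodup, List.pairwise_filterMap, List.pairwise_iff_getElem] at hw
  rcases lt_trichotomy i j with h | h | h
  · exact absurd rfl (hw i j hi hj h v h₁ v h₂)
  · exact h
  · exact absurd rfl (hw j i hj hi h v h₂ v h₁)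

theorem exists_vertex {w : List (Slice D)} {v : ZhVertex D}
    (hw : v ∈ w.filterMap fun s => s.piece.vertex) :
    ∃ (i : ℕ) (hi : i < w.length), w[i].piece.vertex = some v := by
  obtain ⟨s, hs, hv⟩ := List.mem_filterMap.1 hw
  obtain ⟨i, hi, rfl⟩ := List.getElem_of_mem hs
  exact ⟨i, hi, hv⟩

/-! ### The value as the determinant of a presentation matrix -/

/-- The free generators belonging to the slices of a word of length `n`. -/
def sliceGen (g n j : ℕ) : Fin n → Laurent g :=
  if h : j < n then Pi.single ⟨j, h⟩ 1 else 0

/-- The matrix with rows `C`. -/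
def rowMatrix {n : ℕ} (C : List (Fin n → Laurent g)) (hC : C.length = n) :
    Matrix (Fin n) (Fin n) (Laurent g) :=
  Matrix.of fun i => C[i]

/-- The determinant as a linear functional on the exterior algebra. -/
def detFunctional (g n : ℕ) : ExteriorAlgebra (Laurent g) (Fin n → Laurent g) →ₗ[Laurent g]
    Laurent g :=
  ExteriorAlgebra.liftAlternating (Pi.single n Matrix.detRowAlternating)

theorem detFunctional_wedgeList {n : ℕ} (C : List (Fin n → Laurent g)) (hC : C.length = n) :
    detFunctional g n (wedgeList C) = (rowMatrix C hC).det := by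
  have : wedgeList (g := g) C = ExteriorAlgebra.ιMulti (Laurent g) n fun i : Fin n => C[i] := by
    rw [ExteriorAlgebra.ιMulti_apply, wedgeList]
    congr 1
    apply List.ext_getElem
    · simp [hC]
    · intro i h₁ h₂
      simp
  rw [this, detFunctional, ExteriorAlgebra.liftAlternating_apply_ιMulti]
  simp [rowMatrix, Matrix.det]
  rfl

/-- At the end the section is empty, and the determinantal form compares two products of top degree.
The determinant functional sends the product of the standard generators to `1`. -/
theorem ZhDiagram.exists_relations {L : LinkDiagram g} (Z : ZhDiagram L) :
    ∃ (St : _) (out : _) (gen : _) (h : IsRun Z.order Z.word (sliceGen g Z.word.length) St out gen)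
      (u : (Laurent g)ˣ), Z.value = u * (rowMatrix (St Z.word.length).2 h.length_relations).det := by
  obtain ⟨St, out, gen, h⟩ := exists_isRun Z.closed (sliceGen g Z.word.length)
  refine ⟨St, out, gen, h, ?_⟩
  obtain ⟨-, u, hu⟩ := h.isDeterminantal Z.word.length le_rfl
  refine ⟨u, ?_⟩
  have := hu [] (by simp [h.endpoint]) (by simp [h.endpoint, charge])
  rw [h.endpoint, wedge_nil, one_mul, List.take_length] at this
  have h2 := congrArg (detFunctional g Z.word.length) this
  rw [map_smul, map_smul, detFunctional_wedgeList _ (by simp),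
    detFunctional_wedgeList _ h.length_relations] at h2
  have h1 : (rowMatrix ((List.range Z.word.length).map (sliceGen g Z.word.length))
      (by simp)).det = 1 := by
    convert Matrix.det_one (n := Fin Z.word.length) (R := Laurent g)
    ext i j
    simp [rowMatrix, sliceGen, Matrix.one_apply, Pi.single_apply, eq_comm]
  rw [h1, smul_eq_mul, smul_eq_mul, mul_one] at h2
  exact h2

theorem rowMatrix_mem {n : ℕ} {C : List (Fin n → Laurent g)} (hC : C.length = n)
    {r : Fin n → Laurent g} (hr : r ∈ C) : ∃ i, rowMatrix C hC i = r := by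
  obtain ⟨i, hi, rfl⟩ := List.getElem_of_mem hr
  exact ⟨⟨i, hC ▸ hi⟩, rfl⟩

/-- The coefficients of `genValue`. -/
def genCoeff : Option (D.Pass × ℤ) → D.Pass → Laurent g
  | some (e, n) => Pi.single e (qPow g n)
  | none => 0

theorem genValue_eq_sum {N : Type*} [AddCommGroup N] [Module (Laurent g) N] (b : D.Pass → N)
    (o : Option (D.Pass × ℤ)) : genValue b o = ∑ p, genCoeff o p • b p := by
  rcases o with _ | ⟨e, n⟩
  · simp [genValue, genCoeff]
  · rw [Finset.sum_eq_single e (fun p _ hp => by simp [genCoeff, Pi.single_eq_of_ne hp]) (by simp)]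
    simp [genValue, genCoeff]

/-- The generator of a cup goes to the element of its arc, up to a power of `q`, and all others go
to zero. The Fox relations in `N` make the relations of the run hold; conversely, in the cokernel of
the run matrix the vectors leaving the vertices satisfy the Fox relations, so no further relation is
possible. -/
theorem IsRun.isSquarePresentation {L : LinkDiagram g} (Z : ZhDiagram L) {St out gen}
    (h : IsRun Z.order Z.word (sliceGen g Z.word.length) St out gen)
    {N : Type*} [AddCommGroup N] [Module (Laurent g) N] {a : L.Pass → N}
    (ha : IsSquarePresentation (L.foxMatrix.map (substitution g)) a) :
    IsSquarePresentation (rowMatrix (St Z.word.length).2 h.length_relations)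
      (fun j : Fin Z.word.length => genValue a (gen j)) := by
  classical
  have ha' : ∀ p, a p = outValue a p :=
    (foxRelation_iff a).1 fun p => (L.sum_foxMatrix_smul _ a p).1 (ha.relation p)
  have hex : ∀ e : L.Pass, ∃ j, ∃ hj : j < Z.word.length, Z.word[j].piece.vertex = some (vertexOf e) :=
    fun e => exists_vertex (Z.vertex_mem _)
  set π : (Fin Z.word.length → Laurent g) →ₗ[Laurent g] N :=
    Fintype.linearCombination (Laurent g) fun j : Fin Z.word.length => genValue a (gen j) with hπ
  have hπapply : ∀ c, π c = ∑ j, c j • genValue a (gen j) := fun c => rfl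
  have hfwd := h.matches_forward (π := π) ha' (by
    intro j hj
    rw [hπ, sliceGen, dif_pos hj, Fintype.linearCombination_apply_single, one_smul])
  constructor
  -- Every arc leaves some vertex of the word, so its element is the image of the vector `out`
  -- there, a combination of the generators.
  · have hspan : Submodule.span (Laurent g) (Set.range fun j : Fin Z.word.length => genValue a (gen j))
        = LinearMap.range π := (Fintype.range_linearCombination _ _).symm
    rw [hspan, eq_top_iff, ← ha.span_eq, Submodule.span_le]
    rintro _ ⟨e, rfl⟩
    obtain ⟨j, hj, hv⟩ := hex e
    exact ⟨out j e, (h.map_out j hj (hfwd j hj.le).1 e hv).trans (ha' e).symm⟩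
  · intro i
    rw [← hπapply]
    exact (hfwd _ le_rfl).2 _ (List.getElem_mem _)
  · intro c hc
    set A := rowMatrix (St Z.word.length).2 h.length_relations with hA
    have hq := isSquarePresentation_quotient A
    set τ := (Submodule.span (Laurent g) (Set.range A.row)).mkQ with hτ
    have hrel : ∀ r ∈ (St Z.word.length).2, τ r = 0 := by
      intro r hr
      obtain ⟨i, rfl⟩ := rowMatrix_mem h.length_relations hr
      rw [hτ, Submodule.mkQ_apply, Submodule.Quotient.mk_eq_zero]
      exact Submodule.subset_span ⟨i, rfl⟩
    choose T hT hTv using hex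
    -- Each vertex occurs once in the word, so the class assigned to an arc does not depend on the
    -- slice.
    have hout : ∀ j (hj : j < Z.word.length) e, Z.word[j].piece.vertex = some (vertexOf e) →
        τ (out j e) = τ (out (T e) e) := by
      intro j hj e hv
      rw [unique_vertex Z.vertex_nodup hv (hTv e)]
    have hmatch := h.matches_of_relations (π := τ) (b := fun e => τ (out (T e) e)) hrel hout
    have hb : ∀ p, L.FoxRelation (substitution g) (fun e => τ (out (T e) e)) p :=
      (foxRelation_iff _).2 fun e => h.map_out (T e) (hT e) (hmatch _ (hT e).le) e (hTv e)
    have hgen := h.gen_eq hrel hmatch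
    -- Completeness of the given presentation: a relation among the `a p` is a combination of Fox
    -- rows, hence also holds among the classes in the cokernel.
    have hcomb : ∀ x : L.Pass → Laurent g, ∑ p, x p • a p = 0 →
        ∑ p, x p • τ (out (T p) p) = 0 := by
      intro x hx
      obtain ⟨y, rfl⟩ := ha.complete x hx
      have : ∀ p, (Matrix.vecMul y (L.foxMatrix.map (substitution g))) p
          = ∑ i, y i * (L.foxMatrix.map (substitution g)) i p := fun p => rfl
      simp only [this, Finset.sum_smul, mul_smul]
      rw [Finset.sum_comm]
      simp only [← Finset.smul_sum, (L.sum_foxMatrix_smul _ _ _).2 (hb _), smul_zero,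
        Finset.sum_const_zero]
    apply hq.complete
    have hsingle : ∀ j : Fin Z.word.length, τ (Pi.single j 1)
        = genValue (fun e => τ (out (T e) e)) (gen j) := by
      intro j
      rw [← hgen j j.2, sliceGen, dif_pos j.2]
    simp only [hsingle]
    have h₀ : ∑ p, (∑ j, c j * genCoeff (gen j) p) • a p = 0 := by
      rw [← hc]
      simp only [genValue_eq_sum, Finset.smul_sum, smul_smul, Finset.sum_smul]
      exact Finset.sum_comm
    rw [← hcomb _ h₀]
    simp only [genValue_eq_sum, Finset.smul_sum, smul_smul, Finset.sum_smul]
    exact Finset.sum_comm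

theorem ZhDiagram.exists_value_eq {L : LinkDiagram g} (Z : ZhDiagram L) :
    ∃ u : (Laurent g)ˣ, Z.value = u * substitution g L.foxMatrix.det := by
  obtain ⟨St, out, gen, h, u, hu⟩ := Z.exists_relations
  have ha := isSquarePresentation_quotient (L.foxMatrix.map (substitution g))
  have h₁ := ha.zerothOrderIdeal_eq
  rw [(h.isSquarePresentation Z ha).zerothOrderIdeal_eq, Ideal.span_singleton_eq_span_singleton]
    at h₁
  obtain ⟨v, hv⟩ := h₁.symm
  refine ⟨u * v, ?_⟩
  rw [hu, ← hv, RingHom.map_det, Units.val_mul]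
  simp only [RingHom.mapMatrix_apply]
  ring

end

/-! ### Existence of diagrams of the Zh-construction -/

section

variable {g : ℕ} {D : DiagramData g}

/-- A permutation whose cycles are the fibres of a given map. -/
theorem exists_perm_sameCycle_iff {α β : Type*} [Finite α] (f : α → β) :
    ∃ σ : Equiv.Perm α, ∀ a b, σ.SameCycle a b ↔ f a = f b := by
  classical
  -- A single cycle is chosen on each fibre; the cycles are then assembled over the disjoint union
  -- of the fibres.
  have h : ∀ y : β, ∃ τ : Equiv.Perm {x // f x = y}, ∀ a b, τ.SameCycle a b := by
    intro y
    have := Fintype.ofFinite {x // f x = y}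
    obtain ⟨τ, hτ, -⟩ := (Finset.univ : Finset {x // f x = y}).exists_cycleOn
    exact ⟨τ, fun a b => hτ.2 (by simp) (by simp)⟩
  choose τ hτ using h
  let e := Equiv.sigmaFiberEquiv f
  let F : Equiv.Perm (Σ y, {x // f x = y}) := Equiv.Perm.sigmaCongrRightHom _ τ
  have hF : ∀ (n : ℤ) (y : β) (x : {x // f x = y}), (F ^ n) ⟨y, x⟩ = ⟨y, (τ y ^ n) x⟩ := by
    intro n y x
    have : F ^ n = Equiv.Perm.sigmaCongrRightHom _ (τ ^ n) := (map_zpow _ _ _).symm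
    rw [this]
    rfl
  refine ⟨e.permCongr F, fun a b => ?_⟩
  have hpow : ∀ n : ℤ, (e.permCongr F ^ n) a = e ((F ^ n) ⟨f a, a, rfl⟩) := by
    intro n
    have : e.permCongr F ^ n = e.permCongr (F ^ n) :=
      (map_zpow (e.permCongrHom) F n).symm
    rw [this]
    rfl
  constructor
  · rintro ⟨n, rfl⟩
    rw [hpow, hF]
    exact ((τ (f a) ^ n) ⟨a, rfl⟩).2.symm
  · intro hab
    obtain ⟨n, hn⟩ := hτ (f a) ⟨a, rfl⟩ ⟨b, hab.symm⟩
    refine ⟨n, ?_⟩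
    rw [hpow, hF, hn]
    rfl

/-- Points of the coloured components as a sum of finite types. -/
def colorPointEquiv (D : DiagramData g) : ColorPoint D ≃ (Σ z, Fin (D.cuts z)) ⊕ Palette g where
  toFun
    | .over z k => .inl ⟨z, k⟩
    | .mark z => .inr z
  invFun
    | .inl ⟨z, k⟩ => .over z k
    | .inr z => .mark z
  left_inv p := by cases p <;> rfl
  right_inv p := by rcases p with ⟨z, k⟩ | z <;> rfl

instance : Fintype (ColorPoint D) := Fintype.ofEquiv _ (colorPointEquiv D).symm

/-- Vertices of the Gauss diagram as a sum of finite types. -/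
def zhVertexEquiv (D : DiagramData g) :
    ZhVertex D ≃ (Fin D.crossings ⊕ Σ z, Fin (D.cuts z)) ⊕ Fin D.marks ⊕ Palette g where
  toFun
    | .cross c => .inl (.inl c)
    | .colorCross z k => .inl (.inr ⟨z, k⟩)
    | .mark b => .inr (.inl b)
    | .colorMark z => .inr (.inr z)
  invFun
    | .inl (.inl c) => .cross c
    | .inl (.inr ⟨z, k⟩) => .colorCross z k
    | .inr (.inl b) => .mark b
    | .inr (.inr z) => .colorMark z
  left_inv p := by cases p <;> rfl
  right_inv p := by rcases p with (c | ⟨z, k⟩) | b | z <;> rfl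

instance : Fintype (ZhVertex D) := Fintype.ofEquiv _ (zhVertexEquiv D).symm

theorem IsTangle.append {ord : Equiv.Perm (ColorPoint D)} {b c : List (SectionPoint D)}
    {w' : List (Slice D)} (h' : IsTangle ord b w' c) :
    ∀ {w : List (Slice D)} {a : List (SectionPoint D)}, IsTangle ord a w b →
      IsTangle ord a (w ++ w') c
  | [], _, h => by
    obtain rfl := h
    exact h'
  | _ :: _, _, h => ⟨h.1, h'.append h.2⟩

/-- There is a tangle from `a` to `b` with vertices `vs`. -/
def Reaches (ord : Equiv.Perm (ColorPoint D)) (vs : List (ZhVertex D))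
    (a b : List (SectionPoint D)) : Prop :=
  ∃ w : List (Slice D), IsTangle ord a w b ∧ (w.filterMap fun s => s.piece.vertex) = vs

section Reaches

variable {ord : Equiv.Perm (ColorPoint D)} {a b c : List (SectionPoint D)}
  {vs vs' : List (ZhVertex D)}

theorem Reaches.refl (a : List (SectionPoint D)) : Reaches ord [] a a := ⟨[], rfl, rfl⟩

theorem Reaches.trans (h : Reaches ord vs a b) (h' : Reaches ord vs' b c) :
    Reaches ord (vs ++ vs') a c := by
  obtain ⟨w, hw, rfl⟩ := h
  obtain ⟨w', hw', rfl⟩ := h'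
  exact ⟨w ++ w', hw'.append hw, List.filterMap_append⟩

theorem Reaches.slice (l r : List (SectionPoint D)) (p : Piece D) :
    Reaches ord p.vertex.toList (l ++ p.dom ord ++ r) (l ++ p.cod ++ r) := by
  refine ⟨[⟨l, p, r⟩], ⟨rfl, rfl⟩, ?_⟩
  cases h : p.vertex <;> simp [h]

/-- A point oriented upwards. -/
def upPoint (i : ℕ) (e : Arc D) : SectionPoint D := ⟨e, i, true⟩

/-- A point oriented downwards, after one turn. -/
def downPoint (e : Arc D) : SectionPoint D := ⟨e, 1, false⟩

theorem reaches_perm (i : ℕ) {es es' : List (Arc D)} (h : es.Perm es') :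
    ∀ l r : List (SectionPoint D),
      Reaches ord [] (l ++ es.map (upPoint i) ++ r) (l ++ es'.map (upPoint i) ++ r) := by
  induction h with
  | nil => exact fun l r => .refl _
  | cons x _ ih =>
    intro l r
    simpa using ih (l ++ [upPoint i x]) r
  | swap x y es =>
    intro l r
    have := Reaches.slice (ord := ord) l (es.map (upPoint i) ++ r) (.virt y i x i)
    simpa [Piece.dom, Piece.cod, Piece.vertex, upPoint] using this
  | trans _ _ ih₁ ih₂ => exact fun l r => (ih₁ l r).trans (ih₂ l r)

/-- Nested minima, one for each arc. The turn counts anticipate the final closure: an arc leaves its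
vertex with count `0`, descends with count `1` after its maximum and arrives with count `2` after
its minimum. -/
theorem reaches_cups (es : List (Arc D)) : ∀ l r : List (SectionPoint D),
    Reaches ord [] (l ++ r) (l ++ es.map (upPoint 2) ++ ((es.map downPoint).reverse ++ r)) := by
  induction es with
  | nil =>
    intro l r
    simpa using Reaches.refl (ord := ord) (l ++ r)
  | cons e es ih =>
    intro l r
    have h₁ := Reaches.slice (ord := ord) l r (.cup e 1 true)
    have h₂ := ih (l ++ [upPoint 2 e]) (downPoint e :: r)
    have := h₁.trans (vs' := []) (c := l ++ [upPoint 2 e] ++ es.map (upPoint 2)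
      ++ ((es.map downPoint).reverse ++ downPoint e :: r)) (by
        simpa [Piece.cod, upPoint, downPoint] using h₂)
    simpa [Piece.dom, Piece.vertex] using this

theorem reaches_caps (es : List (Arc D)) :
    Reaches ord [] (es.map (upPoint 0) ++ (es.map downPoint).reverse) [] := by
  induction es using List.reverseRecOn with
  | nil => exact .refl _
  | append_singleton es e ih =>
    have h := Reaches.slice (ord := ord) (es.map (upPoint 0)) (es.map downPoint).reverse
      (.cap e 0 true)
    have := h.trans (vs' := []) (c := []) (by simpa [Piece.cod] using ih)
    simpa [Piece.dom, Piece.vertex, upPoint, downPoint] using this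

/-- The elementary tangle with a given vertex, with two turns before it on each strand. -/
def vertexPiece : ZhVertex D → Piece D
  | .cross c => .cross c 2 2
  | .colorCross z k => .colorCross z k 2 2
  | .mark b => .mark b 2
  | .colorMark z => .colorMark z 2

theorem vertex_vertexPiece (v : ZhVertex D) : (vertexPiece v).vertex = some v := by
  cases v <;> rfl

/-- The arcs arriving at a vertex, from left to right. -/
def inArcs (ord : Equiv.Perm (ColorPoint D)) (v : ZhVertex D) : List (Arc D) :=
  ((vertexPiece v).dom ord).map SectionPoint.arc

/-- The arcs leaving a vertex, from left to right. -/
def outArcs (v : ZhVertex D) : List (Arc D) := (vertexPiece v).cod.map SectionPoint.arc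

theorem map_inArcs (v : ZhVertex D) :
    (inArcs ord v).map (upPoint 2) = (vertexPiece v).dom ord := by
  rcases v with c | ⟨z, k⟩ | b | z
  · by_cases h : D.sign c = 1 <;> simp [inArcs, vertexPiece, Piece.dom, upPoint, h]
  · by_cases h : D.liftSign z k = 1 <;> simp [inArcs, vertexPiece, Piece.dom, upPoint, h]
  · simp [inArcs, vertexPiece, Piece.dom, upPoint]
  · simp [inArcs, vertexPiece, Piece.dom, upPoint]

theorem map_outArcs (v : ZhVertex D) : (outArcs v).map (upPoint 0) = (vertexPiece v).cod := by
  rcases v with c | ⟨z, k⟩ | b | z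
  · by_cases h : D.sign c = 1 <;> simp [outArcs, vertexPiece, Piece.cod, upPoint, h]
  · by_cases h : D.liftSign z k = 1 <;> simp [outArcs, vertexPiece, Piece.cod, upPoint, h]
  · simp [outArcs, vertexPiece, Piece.cod, upPoint]
  · simp [outArcs, vertexPiece, Piece.cod, upPoint]

theorem reaches_vertices (vs : List (ZhVertex D)) : ∀ l r : List (SectionPoint D),
    Reaches ord vs (l ++ (vs.flatMap (inArcs ord)).map (upPoint 2) ++ r)
      (l ++ (vs.flatMap outArcs).map (upPoint 0) ++ r) := by
  induction vs with
  | nil => exact fun l r => .refl _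
  | cons v vs ih =>
    intro l r
    have h₁ := Reaches.slice (ord := ord) l ((vs.flatMap (inArcs ord)).map (upPoint 2) ++ r)
      (vertexPiece v)
    have h₂ := ih (l ++ (vertexPiece v).cod) r
    have := h₁.trans (vs' := vs) (by simpa using h₂)
    simpa [map_inArcs, map_outArcs, vertex_vertexPiece] using this

/-- The vertex left by an arc. -/
def startVertex : Arc D → ZhVertex D
  | .inl e => DiagramData.vertexOf e
  | .inr (.over z k) => .colorCross z k
  | .inr (.mark z) => .colorMark z

/-- The next arc along the component. -/
def nextArc (ord : Equiv.Perm (ColorPoint D)) : Equiv.Perm (Arc D) := Equiv.sumCongr D.next ord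

theorem mem_outArcs (v : ZhVertex D) (e : Arc D) : e ∈ outArcs v ↔ startVertex e = v := by
  have h : ∀ v : ZhVertex D, outArcs v = (vertexPiece v).cod.map SectionPoint.arc := fun v => rfl
  rcases v with c | ⟨z, k⟩ | b | z
  · by_cases hs : D.sign c = 1 <;> rcases e with (c' | c' | ⟨z', k'⟩ | b') | ⟨z', k'⟩ | z' <;>
      simp [h, vertexPiece, Piece.cod, hs, startVertex, DiagramData.vertexOf]
  · by_cases hs : D.liftSign z k = 1 <;>
      rcases e with (c' | c' | ⟨z', k'⟩ | b') | ⟨z', k'⟩ | z' <;>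
      simp [h, vertexPiece, Piece.cod, hs, startVertex, DiagramData.vertexOf]
  · rcases e with (c' | c' | ⟨z', k'⟩ | b') | ⟨z', k'⟩ | z' <;>
      simp [h, vertexPiece, Piece.cod, startVertex, DiagramData.vertexOf]
  · rcases e with (c' | c' | ⟨z', k'⟩ | b') | ⟨z', k'⟩ | z' <;>
      simp [h, vertexPiece, Piece.cod, startVertex, DiagramData.vertexOf]

theorem nodup_outArcs (v : ZhVertex D) : (outArcs v).Nodup := by
  rcases v with c | ⟨z, k⟩ | b | z
  · by_cases h : D.sign c = 1 <;> simp [outArcs, vertexPiece, Piece.cod, h]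
  · by_cases h : D.liftSign z k = 1 <;> simp [outArcs, vertexPiece, Piece.cod, h]
  · simp [outArcs, vertexPiece, Piece.cod]
  · simp [outArcs, vertexPiece, Piece.cod]

/-- The two strands of a crossing exchange sides, so as lists the incoming and outgoing arcs agree
only after a swap. -/
theorem inArcs_perm (v : ZhVertex D) :
    (inArcs ord v).Perm ((outArcs v).map (nextArc ord).symm) := by
  have hl : ∀ e : D.Pass, (nextArc ord).symm (.inl e) = .inl (D.next.symm e) := fun e => rfl
  have hr : ∀ e : ColorPoint D, (nextArc ord).symm (.inr e) = .inr (ord.symm e) := fun e => rfl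
  rcases v with c | ⟨z, k⟩ | b | z
  · by_cases h : D.sign c = 1
    · simpa [inArcs, outArcs, vertexPiece, Piece.dom, Piece.cod, h, hl, hr] using List.Perm.swap _ _ _
    · simpa [inArcs, outArcs, vertexPiece, Piece.dom, Piece.cod, h, hl, hr] using List.Perm.swap _ _ _
  · by_cases h : D.liftSign z k = 1
    · simpa [inArcs, outArcs, vertexPiece, Piece.dom, Piece.cod, h, hl, hr] using List.Perm.swap _ _ _
    · simpa [inArcs, outArcs, vertexPiece, Piece.dom, Piece.cod, h, hl, hr] using List.Perm.swap _ _ _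
  · simp [inArcs, outArcs, vertexPiece, Piece.dom, Piece.cod, hl]
  · simp [inArcs, outArcs, vertexPiece, Piece.dom, Piece.cod, hr]

theorem perm_flatMap_outArcs :
    (Finset.univ : Finset (Arc D)).toList.Perm
      ((Finset.univ : Finset (ZhVertex D)).toList.flatMap outArcs) := by
  rw [List.perm_ext_iff_of_nodup (Finset.nodup_toList _)]
  · simp [mem_outArcs]
  · rw [List.nodup_flatMap]
    refine ⟨fun v _ => nodup_outArcs v, (Finset.nodup_toList _).imp fun {v v'} hne e he he' => ?_⟩
    exact hne (((mem_outArcs v e).1 he).symm.trans ((mem_outArcs v' e).1 he'))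

theorem perm_flatMap_inArcs :
    (Finset.univ : Finset (Arc D)).toList.Perm
      ((Finset.univ : Finset (ZhVertex D)).toList.flatMap (inArcs ord)) := by
  have h₁ : ((Finset.univ : Finset (ZhVertex D)).toList.flatMap (inArcs ord)).Perm
      ((Finset.univ : Finset (ZhVertex D)).toList.flatMap
        fun v => (outArcs v).map (nextArc ord).symm) :=
    List.Perm.flatMap_left _ fun v _ => inArcs_perm v
  rw [← List.map_flatMap] at h₁
  refine List.Perm.trans ?_ ((perm_flatMap_outArcs.map _).trans h₁.symm)
  rw [List.perm_ext_iff_of_nodup (Finset.nodup_toList _)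
    ((Finset.nodup_toList _).map (nextArc ord).symm.injective)]
  intro e
  simp only [Finset.mem_toList, Finset.mem_univ, List.mem_map, true_and, true_iff]
  exact ⟨nextArc ord e, (nextArc ord).symm_apply_apply e⟩

end Reaches

/-- One cup is drawn for each arc, the upward ends are sorted by virtual crossings, all vertices are
placed side by side, the outgoing ends are sorted back and everything is closed by nested caps. -/
theorem nonempty_zhDiagram (L : LinkDiagram g) : Nonempty (ZhDiagram L) := by
  obtain ⟨ord, hord⟩ := exists_perm_sameCycle_iff (ColorPoint.color (D := L.toDiagramData))
  set es := (Finset.univ : Finset (Arc L.toDiagramData)).toList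
  set vs := (Finset.univ : Finset (ZhVertex L.toDiagramData)).toList
  have h₁ := reaches_cups (ord := ord) es [] []
  have h₂ := reaches_perm (ord := ord) 2 (perm_flatMap_inArcs (ord := ord)) []
    ((es.map downPoint).reverse ++ [])
  have h₃ := reaches_vertices (ord := ord) vs [] ((es.map downPoint).reverse ++ [])
  have h₄ := reaches_perm (ord := ord) 0 (perm_flatMap_outArcs (D := L.toDiagramData)).symm []
    ((es.map downPoint).reverse ++ [])
  have h₅ : Reaches ord [] ([] ++ es.map (upPoint 0) ++ ((es.map downPoint).reverse ++ [])) [] := by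
    simpa using reaches_caps (ord := ord) es
  obtain ⟨w, hw, hv⟩ := h₁.trans (h₂.trans (h₃.trans (h₄.trans h₅)))
  simp only [List.nil_append, List.append_nil] at hv
  exact ⟨⟨ord, hord, w, hw, hv ▸ Finset.nodup_toList _, fun v => hv ▸ by simp [vs]⟩⟩

end

end CSW
end

theorem theorem5p4 (g : ℕ) (hg : 0 < g) (D : CSW.LinkDiagram g) :
    (∃ Δ : CSW.Laurent g, CSW.IsCSWPolynomial D Δ) ∧ Nonempty (CSW.ZhDiagram D) ∧
      ∀ (Δ : CSW.Laurent g), CSW.IsCSWPolynomial D Δ → ∀ Z : CSW.ZhDiagram D,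
        ∃ u : (CSW.Laurent g)ˣ, Z.value = u * CSW.substitution g Δ := by
  refine ⟨⟨_, D.zerothOrderIdeal_alexanderModule⟩, CSW.nonempty_zhDiagram D, fun Δ hΔ Z => ?_⟩
  obtain ⟨u, hu⟩ := Z.exists_value_eq
  have h : Ideal.span {Δ} = Ideal.span {D.foxMatrix.det} :=
    Eq.trans (Eq.symm hΔ) D.zerothOrderIdeal_alexanderModule
  obtain ⟨v, hv⟩ := Ideal.span_singleton_eq_span_singleton.1 h
  -- The unit by which `Δ` differs from the Fox determinant stays a unit under the substitution,
  -- which is a ring homomorphism.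
  refine ⟨u * Units.map (CSW.substitution g).toMonoidHom v, ?_⟩
  rw [hu, ← hv, map_mul, Units.val_mul, Units.coe_map]
  simp only [RingHom.toMonoidHom_eq_coe, MonoidHom.coe_coe]
  ring
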